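/- Theorem. The index set of the class of cancellable torsion-free countable abelian groups is $\Pi^1_1$ $m$-hard, and this relativizes to every oracle. Explicitly: let $X:\mathbb N\to\mathbb N$ be any oracle (for $X=0$ one obtains the unrelativized statement). For every $\Pi^1_1(X)$ set $S\subseteq\mathbb N$ there is a computable function $f:\mathbb N\to\mathbb N$ such that for all $n$, $$ n\in S \iff f(n)\in I^X, $$ where $$ I^X=\{e\in\mathbb N \mid \text{the } e\text{-th } X\text{-computable structure is a torsion-free abelian group which is cancellable}\}. $$ Here an abelian group $A$ is cancellable if, for all abelian groups $G$ and $H$ (of any cardinality), $A\oplus G\cong A\oplus H$ implies $G\cong H$. A number $e$ is an index of an $X$-computable copy of a countable abelian group $A$ if, for some injection $\iota:A\to\mathbb N$, the $e$-th $X$-partial computable function $\varphi^X_e$ satisfies $\varphi_e^X(\langle 0,a\rangle)=1$ for $a\in\iota(A)$, $\varphi_e^X(\langle 0,a\rangle)=0$ for $a\notin\iota(A)$, and $\varphi^X_e(\langle 1,\langle\iota(g),\iota(h)\rangle\rangle)=\iota(g+h)$ for all $g,h\in A$. A set $S\subseteq\mathbb N$ is $\Pi^1_1(X)$ if there is a relation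 $P(F,n)$ of functions $F:\mathbb N\to\mathbb N$ and numbers $n$, arithmetical in $X$, such that $n\in S\iff\forall F\,P(F,n)$. -/

import Mathlib

universe u v

/-! ## Oracle programs and the standard numbering of the `X`-partial computable functions -/

/-- Programs with an oracle: the programs of `Nat.Partrec.Code` (in the form used by
`Nat.RecursiveIn`) with one additional instruction that queries the oracle. -/
inductive OracleCode : Type
  | zero : OracleCode
  | succ : OracleCode
  | left : OracleCode
  | right : OracleCode
  | oracle : OracleCode
  | pair : OracleCode → OracleCode → OracleCode
  | comp : OracleCode → OracleCode → OracleCode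
  | prec : OracleCode → OracleCode → OracleCode
  | rfind : OracleCode → OracleCode

namespace OracleCode

/-- The partial function computed by a program when the oracle is `X : ℕ → ℕ`. -/
def eval (X : ℕ → ℕ) : OracleCode → ℕ →. ℕ
  | zero => fun _ => Part.some 0
  | succ => fun n => Part.some (n + 1)
  | left => fun n => Part.some n.unpair.1
  | right => fun n => Part.some n.unpair.2
  | oracle => fun n => Part.some (X n)
  | pair c d => fun n => Nat.pair <$> eval X c n <*> eval X d n
  | comp c d => fun n => eval X d n >>= eval X c
  | prec c d => fun p =>
      let (a, n) := Nat.unpair p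
      n.rec (eval X c a) fun y IH => do
        let i ← IH
        eval X d (Nat.pair a (Nat.pair y i))
  | rfind c => fun a =>
      Nat.rfind fun n => (fun m => m = 0) <$> eval X c (Nat.pair a n)

/-- The Gödel number of a program. -/
def encodeCode : OracleCode → ℕ
  | zero => 0
  | succ => 1
  | left => 2
  | right => 3
  | oracle => 4
  | pair c d => 4 * Nat.pair (encodeCode c) (encodeCode d) + 5
  | comp c d => 4 * Nat.pair (encodeCode c) (encodeCode d) + 6
  | prec c d => 4 * Nat.pair (encodeCode c) (encodeCode d) + 7
  | rfind c => 4 * encodeCode c + 8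

/-- The program with a given Gödel number (every natural number is one, see
`encodeCode_ofNatCode`). -/
def ofNatCode : ℕ → OracleCode
  | 0 => zero
  | 1 => succ
  | 2 => left
  | 3 => right
  | 4 => oracle
  | n + 5 =>
    let m := n / 4
    have hm : m < n + 5 := by omega
    have _h1 : m.unpair.1 < n + 5 := lt_of_le_of_lt m.unpair_left_le hm
    have _h2 : m.unpair.2 < n + 5 := lt_of_le_of_lt m.unpair_right_le hm
    match n % 4 with
    | 0 => pair (ofNatCode m.unpair.1) (ofNatCode m.unpair.2)
    | 1 => comp (ofNatCode m.unpair.1) (ofNatCode m.unpair.2)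
    | 2 => prec (ofNatCode m.unpair.1) (ofNatCode m.unpair.2)
    | _ => rfind (ofNatCode m)
decreasing_by
  all_goals first | exact _h1 | exact _h2 | exact hm

theorem ofNatCode_encodeCode (c : OracleCode) : ofNatCode (encodeCode c) = c := by
  induction c with
  | zero => simp [encodeCode, ofNatCode]
  | succ => simp [encodeCode, ofNatCode]
  | left => simp [encodeCode, ofNatCode]
  | right => simp [encodeCode, ofNatCode]
  | oracle => simp [encodeCode, ofNatCode]
  | pair c d hc hd =>
    simp [encodeCode, ofNatCode, hc, hd]
  | comp c d hc hd =>
    have h : ∀ k : ℕ, (4 * k + 1) / 4 = k ∧ (4 * k + 1) % 4 = 1 := fun k => by omega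
    rw [encodeCode, show ∀ k : ℕ, 4 * k + 6 = (4 * k + 1) + 5 from fun k => by omega,
      ofNatCode]
    simp [h, hc, hd]
  | prec c d hc hd =>
    have h : ∀ k : ℕ, (4 * k + 2) / 4 = k ∧ (4 * k + 2) % 4 = 2 := fun k => by omega
    rw [encodeCode, show ∀ k : ℕ, 4 * k + 7 = (4 * k + 2) + 5 from fun k => by omega,
      ofNatCode]
    simp [h, hc, hd]
  | rfind c hc =>
    have h : ∀ k : ℕ, (4 * k + 3) / 4 = k ∧ (4 * k + 3) % 4 = 3 := fun k => by omega
    rw [encodeCode, show ∀ k : ℕ, 4 * k + 8 = (4 * k + 3) + 5 from fun k => by omega,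
      ofNatCode]
    simp [h, hc]

theorem encodeCode_ofNatCode (n : ℕ) : encodeCode (ofNatCode n) = n := by
  induction n using Nat.strong_induction_on with
  | _ n ih =>
    match n, ih with
    | 0, _ => simp [encodeCode, ofNatCode]
    | 1, _ => simp [encodeCode, ofNatCode]
    | 2, _ => simp [encodeCode, ofNatCode]
    | 3, _ => simp [encodeCode, ofNatCode]
    | 4, _ => simp [encodeCode, ofNatCode]
    | n + 5, ih =>
      have hm : n / 4 < n + 5 := by omega
      have h0 := ih _ hm
      have h1 := ih _ (lt_of_le_of_lt (n / 4).unpair_left_le hm)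
      have h2 := ih _ (lt_of_le_of_lt (n / 4).unpair_right_le hm)
      rw [ofNatCode]
      have h4 : n % 4 = 0 ∨ n % 4 = 1 ∨ n % 4 = 2 ∨ n % 4 = 3 := by omega
      rcases h4 with h | h | h | h <;> simp [h, encodeCode, h0, h1, h2] <;> omega

end OracleCode

/-- The `e`-th `X`-partial computable function. -/
def oraclePhi (X : ℕ → ℕ) (e : ℕ) : ℕ →. ℕ :=
  (OracleCode.ofNatCode e).eval X

/-- The functions `oraclePhi X e` are exactly the partial functions recursive in `X`. -/
theorem exists_oraclePhi_iff (X : ℕ → ℕ) (f : ℕ →. ℕ) :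
    (∃ e, oraclePhi X e = f) ↔ Nat.RecursiveIn {(X : ℕ →. ℕ)} f := by
  constructor
  · rintro ⟨e, rfl⟩
    unfold oraclePhi
    generalize OracleCode.ofNatCode e = c
    induction c with
    | zero => exact .zero
    | succ => exact .succ
    | left => exact .left
    | right => exact .right
    | oracle => exact .oracle _ (Set.mem_singleton _)
    | pair c d hc hd => exact .pair hc hd
    | comp c d hc hd => exact .comp hc hd
    | prec c d hc hd => exact .prec hc hd
    | rfind c hc => exact .rfind hc
  · intro h
    suffices ∃ c : OracleCode, c.eval X = f by
      obtain ⟨c, hc⟩ := this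
      exact ⟨c.encodeCode, by rw [oraclePhi, OracleCode.ofNatCode_encodeCode, hc]⟩
    induction h with
    | zero => exact ⟨.zero, rfl⟩
    | succ => exact ⟨.succ, rfl⟩
    | left => exact ⟨.left, rfl⟩
    | right => exact ⟨.right, rfl⟩
    | oracle g hg =>
      rw [Set.mem_singleton_iff] at hg
      exact ⟨.oracle, hg.symm⟩
    | pair _ _ h₁ h₂ =>
      obtain ⟨c, rfl⟩ := h₁
      obtain ⟨d, rfl⟩ := h₂
      exact ⟨.pair c d, rfl⟩
    | comp _ _ h₁ h₂ =>
      obtain ⟨c, rfl⟩ := h₁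
      obtain ⟨d, rfl⟩ := h₂
      exact ⟨.comp c d, rfl⟩
    | prec _ _ h₁ h₂ =>
      obtain ⟨c, rfl⟩ := h₁
      obtain ⟨d, rfl⟩ := h₂
      exact ⟨.prec c d, rfl⟩
    | rfind _ h₁ =>
      obtain ⟨c, rfl⟩ := h₁
      exact ⟨.rfind c, rfl⟩

/-! ## The class `Π¹₁`, relative to an oracle -/

/-- The relations `P(f, n)` of a function `f : ℕ → ℕ` and a number `n` that are arithmetical
in `X` (several number variables are coded into one by `Nat.pair`): the least class that
contains the relations `s(n) = t(n)` and `f(s(n)) = t(n)` for `X`-computable `s`, `t`, and is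
closed under negation, conjunction and quantification over numbers. -/
inductive ArithmeticalIn (X : ℕ → ℕ) : ((ℕ → ℕ) → ℕ → Prop) → Prop
  | eq {s t : ℕ → ℕ} (hs : ComputableIn {(X : ℕ →. ℕ)} s) (ht : ComputableIn {(X : ℕ →. ℕ)} t) :
      ArithmeticalIn X (fun _ n => s n = t n)
  | app {s t : ℕ → ℕ} (hs : ComputableIn {(X : ℕ →. ℕ)} s) (ht : ComputableIn {(X : ℕ →. ℕ)} t) :
      ArithmeticalIn X (fun f n => f (s n) = t n)
  | not {P : (ℕ → ℕ) → ℕ → Prop} (hP : ArithmeticalIn X P) :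
      ArithmeticalIn X (fun f n => ¬ P f n)
  | and {P Q : (ℕ → ℕ) → ℕ → Prop} (hP : ArithmeticalIn X P) (hQ : ArithmeticalIn X Q) :
      ArithmeticalIn X (fun f n => P f n ∧ Q f n)
  | all {P : (ℕ → ℕ) → ℕ → Prop} (hP : ArithmeticalIn X P) :
      ArithmeticalIn X (fun f n => ∀ m, P f (Nat.pair n m))

/-- `S` is `Π¹₁` relative to `X`: it is defined by a universal quantifier over functions
`ℕ → ℕ` in front of a relation that is arithmetical in `X`. -/
def IsPi11In (X : ℕ → ℕ) (S : Set ℕ) : Prop :=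
  ∃ P : (ℕ → ℕ) → ℕ → Prop, ArithmeticalIn X P ∧ ∀ n, n ∈ S ↔ ∀ f, P f n

/-! ## Computable groups, cancellation and the index set -/

/-- `e` is an index of an `X`-computable copy of the abelian group `G`, with domain a set of
natural numbers: through some identification `ι` of the elements of `G` with numbers,
the `e`-th `X`-partial computable function decides the domain (on inputs `⟨0, a⟩`) and computes
the group operation on the domain (on inputs `⟨1, ⟨a, b⟩⟩`). -/
def IsGroupIndexIn (X : ℕ → ℕ) (e : ℕ) (G : Type v) [AddCommGroup G] : Prop :=
  ∃ ι : G → ℕ, Function.Injective ι ∧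
    (∀ a ∈ Set.range ι, 1 ∈ oraclePhi X e (Nat.pair 0 a)) ∧
    (∀ a ∉ Set.range ι, 0 ∈ oraclePhi X e (Nat.pair 0 a)) ∧
    ∀ g h : G, ι (g + h) ∈ oraclePhi X e (Nat.pair 1 (Nat.pair (ι g) (ι h)))

/-- The abelian group `A` is cancellable: it can be cancelled from direct sums of
(arbitrary) abelian groups. -/
def IsCancellable (A : Type v) [AddCommGroup A] : Prop :=
  ∀ (G H : Type u) [AddCommGroup G] [AddCommGroup H],
    Nonempty (A × G ≃+ A × H) → Nonempty (G ≃+ H)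

/-- The index set, relative to `X`, of the class of cancellable torsion-free countable abelian
groups. -/
def cancellableIndexSet (X : ℕ → ℕ) : Set ℕ :=
  {e | ∃ (A : Type) (_ : AddCommGroup A),
    IsGroupIndexIn X e A ∧ IsAddTorsionFree A ∧ IsCancellable.{u} A}

/-! ## Cancellation -/

/-! The complement of $S$ is the set of $n$ for which a tree, decidable in $X$ uniformly in $n$, has
an infinite path (`IsPi11In.exists_test`). A set of live nodes is turned into a torsion-free group
that is cancellable exactly when there is no path.

The group lives in a rational vector space with basis $x_{k,a,l}$ and $y_{k,n}$: $k$ is a component,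
$a$ an auxiliary copy, $l$ a node, $n$ a level. It is cut out by substitutions of basis elements,
each with its own class of primes at which the image has to be integral. The kernel of a
substitution consists of the elements infinitely divisible by those primes, so endomorphisms
preserve it (`push_endo_eq_zero`). The kernels are spanned by: the $y_{k,n}$ and the live nodes of
level $n$; the differences $x_{k,a,x::l}-x_{k,a,l}$ with $|l|=n$; a single line
$x_{k,a,l}-y_{k,|l|}$.

Without a path: the lines determine $\varphi(x_{k,a,l})$ from $\varphi(y_{k,|l|})$ up to one scalar.
The edges make these scalars agree along edges, and make the node part of $\varphi(y_{k,n+1})$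
project onto that of $\varphi(y_{k,n})$. A nonzero coefficient at a node would thus propagate to a
child again and again, through live nodes only: a path. So $\varphi$ is a scalar on each component
(`endo_apply`). The scalars avoid a set of primes congruent to 3 mod 4 in their denominators; the
primes congruent to 1 mod 4 are units there, and Dirichlet's theorem gives stable range one
(`exists_unit_of_mul_add_eq_one`). Evans's theorem (`EndStableRangeOne.isCancellable`) concludes.

With a path $\sigma$: sending every basis element of level $n$ in component $k$ to
$x_{k,0,\sigma(n)}$ defines an idempotent endomorphism, whose image is a sum of isomorphic copies
indexed by $k$. Shifting the copies gives $A\oplus K\cong A$ with $K\ne0$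
(`not_isCancellable_treeGroup`).

Effectivity: a vector has a finite code, and membership amounts to finitely many conditions that
involve the liveness of finitely many nodes. This yields a copy of the group computable in $X$
uniformly in $n$, and an index is found by fixing one argument of a program. -/

/-- The first stable range condition for the endomorphism ring of an abelian group. -/
def EndStableRangeOne (A : Type v) [AddCommGroup A] : Prop :=
  ∀ f f' g : A →+ A, (∀ a, f (f' a) + g a = a) →
    ∃ x : A →+ A, Function.Bijective fun a => f a + g (x a)

/-- Evans's theorem: a group whose endomorphism ring has stable range one is cancellable. -/
theorem EndStableRangeOne.isCancellable {A : Type v} [AddCommGroup A]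
    (hA : EndStableRangeOne A) : IsCancellable.{u} A := by
  rintro G H _ _ ⟨e⟩
  let α : A →+ A := (AddMonoidHom.fst A H).comp (e.toAddMonoidHom.comp (AddMonoidHom.inl A G))
  let β : G →+ A := (AddMonoidHom.fst A H).comp (e.toAddMonoidHom.comp (AddMonoidHom.inr A G))
  let α' : A →+ A :=
    (AddMonoidHom.fst A G).comp (e.symm.toAddMonoidHom.comp (AddMonoidHom.inl A H))
  let γ' : A →+ G :=
    (AddMonoidHom.snd A G).comp (e.symm.toAddMonoidHom.comp (AddMonoidHom.inl A H))
  have he : ∀ a g, (e (a, g)).1 = α a + β g := fun a g => by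
    have : ((a, g) : A × G) = (a, 0) + (0, g) := by simp
    rw [this, map_add]; rfl
  -- The first row of `e` times the first column of its inverse is the identity of `A`.
  obtain ⟨x, hx⟩ := hA α α' (β.comp γ') (fun a => by
    have h1 : e (α' a, γ' a) = (a, 0) := e.apply_symm_apply (a, 0)
    have h2 := he (α' a) (γ' a)
    rw [h1] at h2
    exact h2.symm)
  -- compose `e` with a transvection so that its first diagonal entry becomes bijective
  let θ : A × G ≃+ A × G :=
    { toFun := fun p => (p.1, p.2 + γ' (x p.1))
      invFun := fun p => (p.1, p.2 - γ' (x p.1))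
      left_inv := fun p => by simp
      right_inv := fun p => by simp
      map_add' := fun p q => by ext <;> simp; abel }
  let e' : A × G ≃+ A × H := θ.trans e
  have he' : ∀ a g, (e' (a, g)).1 = (α a + β (γ' (x a))) + β g := fun a g => by
    change (e (a, g + γ' (x a))).1 = _
    rw [he, map_add]; abel
  let w : A ≃ A := Equiv.ofBijective _ hx
  have hw : ∀ a, α a + β (γ' (x a)) = w a := fun a => rfl
  have hw' : ∀ g, (e' (w.symm (-β g), g)).1 = 0 := fun g => by
    rw [he', hw, Equiv.apply_symm_apply, neg_add_cancel]
  have hwadd : ∀ a b, w (a + b) = w a + w b := fun a b => by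
    simp only [← hw, map_add]; abel
  have hwsymm : ∀ a b, w.symm (a + b) = w.symm a + w.symm b := fun a b => by
    apply w.injective; rw [hwadd]; simp
  -- As `w` is invertible, the preimage of `0 × H` under `e'` is the graph of `g ↦ w⁻¹(-β g)`, which
  -- projects isomorphically to `G`.
  refine ⟨{ toFun := fun g => (e' (w.symm (-β g), g)).2
            invFun := fun h => (e'.symm (0, h)).2
            left_inv := fun g => ?_
            right_inv := fun h => ?_
            map_add' := fun g g' => ?_ }⟩
  · have : ((0, (e' (w.symm (-β g), g)).2) : A × H) = e' (w.symm (-β g), g) :=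
      Prod.ext (hw' g).symm rfl
    simp only [this, AddEquiv.symm_apply_apply]
  · have h1 : e' (e'.symm (0, h)) = (0, h) := e'.apply_symm_apply _
    have h2 := he' (e'.symm (0, h)).1 (e'.symm (0, h)).2
    rw [Prod.mk.eta, h1, hw] at h2
    have h3 : w.symm (-β (e'.symm (0, h)).2) = (e'.symm (0, h)).1 := by
      rw [Equiv.symm_apply_eq, eq_comm]
      exact eq_neg_of_add_eq_zero_left h2.symm
    simp only [h3, Prod.mk.eta, h1]
  · rw [map_add, neg_add, hwsymm, ← Prod.snd_add, ← map_add e', Prod.mk_add_mk]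

/-- A group with a one-sided inverse pair `ψ' ψ = 1` and `ker ψ' ≠ 0` is isomorphic to its own
direct sum with a nonzero group. -/
theorem not_isCancellable_of_leftInverse {A : Type} [AddCommGroup A] (ψ ψ' : A →+ A)
    (h : ∀ a, ψ' (ψ a) = a) (z : A) (hz : ψ' z = 0) (hz0 : z ≠ 0) : ¬ IsCancellable.{u} A := by
  intro hc
  let K := ULift.{u} ψ'.ker
  -- Since `ψ' ∘ ψ = 1`, the group splits as the image of `ψ`, a copy of `A`, plus the kernel of
  -- `ψ'`.
  have e : A × K ≃+ A × PUnit.{u + 1} :=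
    { toFun := fun p => (ψ p.1 + p.2.down, PUnit.unit)
      invFun := fun p => (ψ' p.1, ⟨⟨p.1 - ψ (ψ' p.1), by simp [AddMonoidHom.mem_ker, h]⟩⟩)
      left_inv := fun p => by
        have hp : ψ' (p.2.down : A) = 0 := p.2.down.2
        ext <;> simp [h, hp]
      right_inv := fun p => by ext; simp
      map_add' := fun p q => by
        have hpq : ((p.2 + q.2).down : A) = p.2.down + q.2.down := rfl
        ext
        simp only [Prod.fst_add, map_add, Prod.snd_add, hpq]
        abel }
  obtain ⟨f⟩ := hc K PUnit.{u + 1} ⟨e⟩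
  have h1 : (⟨⟨z, hz⟩⟩ : K) = 0 := f.injective (Subsingleton.elim _ _)
  exact hz0 (congrArg (fun t : K => (t.down : A)) h1)

/-- Cancellability is invariant under isomorphism. -/
theorem IsCancellable.of_addEquiv {A : Type v} {B : Type v} [AddCommGroup A] [AddCommGroup B]
    (e : A ≃+ B) (h : IsCancellable.{u} A) : IsCancellable.{u} B := by
  rintro G H _ _ ⟨f⟩
  exact h G H ⟨((e.prodCongr (AddEquiv.refl G)).trans f).trans
    (e.symm.prodCongr (AddEquiv.refl H))⟩

/-- An index determines the group up to isomorphism. -/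
theorem IsGroupIndexIn.nonempty_addEquiv {X : ℕ → ℕ} {e : ℕ} {A B : Type v} [AddCommGroup A]
    [AddCommGroup B] (hA : IsGroupIndexIn X e A) (hB : IsGroupIndexIn X e B) :
    Nonempty (A ≃+ B) := by
  obtain ⟨i, hi, hi1, hi0, hia⟩ := hA
  obtain ⟨j, hj, hj1, hj0, hja⟩ := hB
  have hr : Set.range i = Set.range j := by
    ext a
    by_cases h1 : a ∈ Set.range i <;> by_cases h2 : a ∈ Set.range j
    · simp [h1, h2]
    · exact absurd (Part.mem_unique (hi1 a h1) (hj0 a h2)) one_ne_zero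
    · exact absurd (Part.mem_unique (hi0 a h1) (hj1 a h2)) zero_ne_one
    · simp [h1, h2]
  let E : A ≃ B := (Equiv.ofInjective i hi).trans
    ((Equiv.setCongr hr).trans (Equiv.ofInjective j hj).symm)
  have hE : ∀ a, j (E a) = i a := fun a => by
    have := Equiv.apply_ofInjective_symm hj ((Equiv.setCongr hr) (Equiv.ofInjective i hi a))
    exact this
  refine ⟨{ E with map_add' := fun a b => ?_ }⟩
  refine hj ?_
  change j (E (a + b)) = j (E a + E b)
  refine Part.mem_unique (o := oraclePhi X e (Nat.pair 1 (Nat.pair (i a) (i b)))) ?_ ?_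
  · rw [hE]
    exact hia a b
  · rw [← hE a, ← hE b]
    exact hja _ _

/-! ## Local integrality of rational numbers -/

/-- `q` lies in the localization of `ℤ` at the prime `p`. -/
def IntegralAt (p : ℕ) (q : ℚ) : Prop := ¬ p ∣ q.den

theorem IntegralAt.div {p : ℕ} (z : ℤ) {n : ℕ} (h : ¬ p ∣ n) : IntegralAt p ((z : ℚ) / n) := by
  intro hp
  apply h
  have h1 := Rat.den_dvd z n
  rw [Rat.divInt_eq_div] at h1
  exact hp.trans (by exact_mod_cast h1)

theorem IntegralAt.intCast {p : ℕ} (hp : p.Prime) (z : ℤ) : IntegralAt p z := by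
  simpa [IntegralAt] using hp.one_lt.ne'

theorem IntegralAt.zero {p : ℕ} (hp : p.Prime) : IntegralAt p 0 := by
  simpa using IntegralAt.intCast hp 0

theorem IntegralAt.one {p : ℕ} (hp : p.Prime) : IntegralAt p 1 := by
  simpa using IntegralAt.intCast hp 1

theorem IntegralAt.add {p : ℕ} (hp : p.Prime) {q r : ℚ} (hq : IntegralAt p q)
    (hr : IntegralAt p r) : IntegralAt p (q + r) := fun h =>
  ((hp.dvd_mul.1 (h.trans (Rat.add_den_dvd q r))).elim hq hr)

theorem IntegralAt.mul {p : ℕ} (hp : p.Prime) {q r : ℚ} (hq : IntegralAt p q)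
    (hr : IntegralAt p r) : IntegralAt p (q * r) := fun h =>
  ((hp.dvd_mul.1 (h.trans (Rat.mul_den_dvd q r))).elim hq hr)

theorem IntegralAt.neg {p : ℕ} {q : ℚ} (hq : IntegralAt p q) : IntegralAt p (-q) := by
  simpa [IntegralAt] using hq

theorem IntegralAt.sum {p : ℕ} (hp : p.Prime) {α : Type*} (s : Finset α) (f : α → ℚ)
    (h : ∀ a ∈ s, IntegralAt p (f a)) : IntegralAt p (∑ a ∈ s, f a) :=
  Finset.sum_induction f (IntegralAt p) (fun _ _ => IntegralAt.add hp) (IntegralAt.zero hp) h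

/-- The numerator would be divisible by every power of `p`. This is what turns infinite divisibility
into vanishing. -/
theorem eq_zero_of_forall_integralAt_div_pow {p : ℕ} (hp : p.Prime) {q : ℚ}
    (h : ∀ j : ℕ, IntegralAt p (q / (p : ℚ) ^ j)) : q = 0 := by
  have hp0 : (p : ℚ) ≠ 0 := by exact_mod_cast hp.ne_zero
  have key : ∀ j : ℕ, p ^ j ∣ q.num.natAbs := fun j => by
    set r := q / (p : ℚ) ^ j with hr
    have h1 : q = r * (p : ℚ) ^ j := by rw [hr]; field_simp
    have h2 : q.num * r.den = r.num * p ^ j * q.den := by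
      have h3 : (q.num : ℚ) * r.den = r.num * p ^ j * q.den := by
        have hq := Rat.num_div_den q
        have hr' := Rat.num_div_den r
        have d1 : (q.den : ℚ) ≠ 0 := by exact_mod_cast q.den_ne_zero
        have d2 : (r.den : ℚ) ≠ 0 := by exact_mod_cast r.den_ne_zero
        rw [div_eq_iff d1] at hq
        rw [div_eq_iff d2] at hr'
        rw [hq, hr', h1]; ring
      exact_mod_cast h3
    have h4 : p ^ j ∣ q.num.natAbs * r.den := by
      have := congrArg Int.natAbs h2
      simp only [Int.natAbs_mul, Int.natAbs_natCast, Int.natAbs_pow] at this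
      rw [this]
      exact Dvd.dvd.mul_right (dvd_mul_left _ _) _
    exact ((Nat.Prime.coprime_iff_not_dvd hp).2 (h j)).pow_left j |>.dvd_of_dvd_mul_right h4
  by_contra hq
  have h5 : 0 < q.num.natAbs := Int.natAbs_pos.2 (Rat.num_ne_zero.2 hq)
  exact absurd (Nat.le_of_dvd h5 (key q.num.natAbs)) (not_le.2 (Nat.lt_pow_self hp.one_lt))

/-- Every positive number splits into a part with all prime factors in `W` and a part with none
of its prime factors in `W`. -/
theorem exists_mul_split (W : Set ℕ) (n : ℕ) (hn : n ≠ 0) :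
    ∃ s t : ℕ, n = s * t ∧ (∀ p, p.Prime → p ∣ s → p ∈ W) ∧ ∀ p, p.Prime → p ∈ W → ¬ p ∣ t := by
  induction n using induction_on_primes with
  | zero => exact absurd rfl hn
  | one =>
    refine ⟨1, 1, rfl, fun p hp h => ?_, fun p hp _ h => ?_⟩ <;>
      exact absurd (Nat.dvd_one.1 h) hp.ne_one
  | prime_mul q a hq ih =>
    obtain ⟨s, t, h, hs, ht⟩ := ih (right_ne_zero_of_mul hn)
    by_cases hqW : q ∈ W
    · refine ⟨q * s, t, by rw [h, mul_assoc], fun p hp hd => ?_, ht⟩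
      rcases hp.dvd_mul.1 hd with h1 | h1
      · rwa [(Nat.prime_dvd_prime_iff_eq hp hq).1 h1]
      · exact hs p hp h1
    · refine ⟨s, q * t, by rw [h, mul_left_comm], hs, fun p hp hpW hd => ?_⟩
      rcases hp.dvd_mul.1 hd with h1 | h1
      · exact hqW ((Nat.prime_dvd_prime_iff_eq hp hq).1 h1 ▸ hpW)
      · exact ht p hp hpW h1

/-- The localization of `ℤ` away from the complement of a set `W` of primes congruent to `3`
modulo `4` has stable range one. -/
theorem exists_unit_of_mul_add_eq_one {W : Set ℕ} (hW : ∀ p ∈ W, p.Prime ∧ p % 4 = 3)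
    {a a' b : ℚ} (ha : ∀ p ∈ W, IntegralAt p a) (ha' : ∀ p ∈ W, IntegralAt p a')
    (hb : ∀ p ∈ W, IntegralAt p b) (h : a * a' + b = 1) :
    ∃ x : ℚ, (∀ p ∈ W, IntegralAt p x) ∧ a + b * x ≠ 0 ∧
      ∀ p ∈ W, IntegralAt p (a + b * x)⁻¹ := by
  by_cases hb0 : b = 0
  · subst hb0
    rw [add_zero] at h
    refine ⟨0, fun p hp => IntegralAt.zero (hW p hp).1, ?_, fun p hp => ?_⟩
    · simpa using left_ne_zero_of_mul_eq_one h
    · rw [zero_mul, add_zero, inv_eq_of_mul_eq_one_right h]; exact ha' p hp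
  set m := a.den * b.den with hm
  set α := a.num * b.den with hα
  set β := b.num * a.den with hβ
  have d1 : (a.den : ℚ) ≠ 0 := by exact_mod_cast a.den_ne_zero
  have d2 : (b.den : ℚ) ≠ 0 := by exact_mod_cast b.den_ne_zero
  have d3 : (a'.den : ℚ) ≠ 0 := by exact_mod_cast a'.den_ne_zero
  have hm0 : (m : ℚ) ≠ 0 := by rw [hm]; push_cast; positivity
  have haq : a = α / m := by
    conv_lhs => rw [← Rat.num_div_den a]
    rw [hα, hm]; push_cast; field_simp
  have hbq : b = β / m := by
    conv_lhs => rw [← Rat.num_div_den b]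
    rw [hβ, hm]; push_cast; field_simp
  have hβ0 : β.natAbs ≠ 0 := by
    rw [Int.natAbs_ne_zero]
    rintro h0
    rw [h0] at hbq
    simp at hbq
    exact hb0 hbq
  -- Only the part `s` matters, since `m` and `t` are units of the localization.
  obtain ⟨s, t, hst, hs, ht⟩ := exists_mul_split W β.natAbs hβ0
  have hs0 : s ≠ 0 := by rintro rfl; simp at hst; exact hβ0 (by simp [hst])
  have ht0 : (t : ℚ) ≠ 0 := by
    have : t ≠ 0 := by rintro rfl; simp at hst; exact hβ0 (by simp [hst])
    exact_mod_cast this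
  have hmW : ∀ p ∈ W, ¬ p ∣ m := fun p hp hd =>
    ((hW p hp).1.dvd_mul.1 hd).elim (ha p hp) (hb p hp)
  have hrel : α * a'.num + β * a'.den = m * a'.den := by
    have h1 : (α : ℚ) * a'.num + β * a'.den = m * a'.den := by
      have h2 := h
      rw [haq, hbq, ← Rat.num_div_den a'] at h2
      field_simp at h2
      linarith
    exact_mod_cast h1
  -- A common prime would lie in `W` and divide `m * a'.den`, which has no prime factor in `W`.
  have hcop : IsCoprime α (s : ℤ) := by
    rw [Int.isCoprime_iff_gcd_eq_one]
    by_contra hg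
    obtain ⟨p, hp, hpd⟩ := Nat.exists_prime_and_dvd hg
    have hpα : (p : ℤ) ∣ α := (Int.natCast_dvd_natCast.2 hpd).trans (Int.gcd_dvd_left _ _)
    have hps : p ∣ s := by
      exact_mod_cast (Int.natCast_dvd_natCast.2 hpd).trans (Int.gcd_dvd_right α (s : ℤ))
    have hpW := hs p hp hps
    have hpβ : (p : ℤ) ∣ β := by
      rw [Int.natCast_dvd, hst]; exact hps.mul_right t
    have h3 : (p : ℤ) ∣ m * a'.den := by
      rw [← hrel]; exact dvd_add (hpα.mul_right _) (hpβ.mul_right _)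
    have h4 : p ∣ m * a'.den := by exact_mod_cast h3
    exact (hp.dvd_mul.1 h4).elim (hmW p hpW) (ha' p hpW)
  have hcop4 : IsCoprime (s : ℤ) 4 := by
    have : Nat.Coprime s 4 := by
      rw [show (4 : ℕ) = 2 ^ 2 from rfl]
      refine Nat.Coprime.pow_right 2 ?_
      rw [Nat.coprime_comm, Nat.Prime.coprime_iff_not_dvd Nat.prime_two]
      intro h2
      have := (hW 2 (hs 2 Nat.prime_two h2)).2
      omega
    exact_mod_cast Nat.isCoprime_iff_coprime.2 this
  obtain ⟨u, w, huw⟩ := hcop4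
  -- `r ≡ α (mod s)` and `r ≡ 1 (mod 4)`
  set r := α * (w * 4) + u * s with hr
  have hrs : r = α + s * (u - α * u) := by rw [hr]; linear_combination α * huw
  have hr4 : r = 1 + 4 * (α * w - w) := by rw [hr]; linear_combination huw
  have hrc : IsCoprime r ((4 * s : ℕ) : ℤ) := by
    push_cast
    refine IsCoprime.mul_right ?_ ?_
    · rw [hr4]; exact isCoprime_one_left.add_mul_left_left _
    · rw [hrs]; exact hcop.add_mul_left_left _
  -- Dirichlet: a prime `q` congruent to 1 mod 4 lies outside `W`, hence is a unit of the
  -- localization.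
  obtain ⟨q, -, hq, hqr⟩ := Nat.forall_exists_prime_gt_and_zmodEq 0 (q := 4 * s)
    (mul_ne_zero four_ne_zero hs0) hrc
  obtain ⟨k, hk⟩ := hqr.symm.dvd
  push_cast at hk
  have hq4 : q % 4 = 1 := by
    have : (q : ℤ) % 4 = 1 := by
      rw [show (q : ℤ) = 1 + 4 * (α * w - w + s * k) by linear_combination hk + hr4]
      omega
    omega
  obtain ⟨y, hy⟩ : ∃ y : ℤ, (q : ℤ) = α + s * y :=
    ⟨u - α * u + 4 * k, by linear_combination hk + hrs⟩
  -- `y'` absorbs the sign of `β = ± s t`.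
  obtain ⟨y', hy'⟩ : ∃ y' : ℤ, s * t * y = β * y' := by
    rcases Int.natAbs_eq β with h1 | h1 <;> rw [h1, hst]
    · exact ⟨y, by push_cast; ring⟩
    · exact ⟨-y, by push_cast; ring⟩
  have hval : a + b * ((y' : ℚ) / t) = q / m := by
    have h1 : (q : ℚ) = α + s * y := by exact_mod_cast hy
    have h2 : (s : ℚ) * t * y = β * y' := by exact_mod_cast hy'
    rw [haq, hbq, h1]
    field_simp
    linear_combination -h2
  have hq0 : (q : ℚ) ≠ 0 := by exact_mod_cast hq.ne_zero
  refine ⟨(y' : ℚ) / t, fun p hp => IntegralAt.div y' (ht p (hW p hp).1 hp), ?_, fun p hp => ?_⟩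
  · rw [hval]; positivity
  · rw [hval, inv_div]
    refine IntegralAt.div (m : ℤ) fun hd => ?_
    rw [Nat.prime_dvd_prime_iff_eq (hW p hp).1 hq] at hd
    have := (hW p hp).2
    omega

/-! ## Classes of primes attached to labels -/

/-- An infinite class of primes attached to the number `e`. Different classes are disjoint, and
all these primes are congruent to `3` modulo `4`. -/
def labelPrimes (e : ℕ) : Set ℕ := {p | p.Prime ∧ p % 2 ^ (e + 3) = 2 ^ (e + 2) - 1}

theorem labelPrimes_nonempty (e : ℕ) : (labelPrimes e).Nonempty := by
  have h1 : Nat.Coprime (2 ^ (e + 2) - 1) (2 ^ (e + 3)) := by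
    refine Nat.Coprime.pow_right _ ?_
    rw [Nat.coprime_comm, Nat.Prime.coprime_iff_not_dvd Nat.prime_two]
    have : 0 < 2 ^ (e + 1) := by positivity
    rw [pow_succ]
    omega
  obtain ⟨p, -, hp, hm⟩ := Nat.forall_exists_prime_gt_and_modEq 0 (q := 2 ^ (e + 3))
    (by positivity) h1
  refine ⟨p, hp, ?_⟩
  rw [hm, Nat.mod_eq_of_lt]
  have : 0 < 2 ^ (e + 2) := by positivity
  rw [pow_succ 2 (e + 2)]
  omega

theorem mod_four_of_mem_labelPrimes {e p : ℕ} (h : p ∈ labelPrimes e) : p % 4 = 3 := by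
  have h1 : p % 2 ^ (e + 3) % 4 = p % 4 :=
    Nat.mod_mod_of_dvd p ⟨2 ^ (e + 1), by rw [pow_add, pow_add]; ring⟩
  rw [h.2] at h1
  have : 0 < 2 ^ e := by positivity
  rw [← h1, pow_add]
  omega

/-- The residue condition says that `2 ^ (e + 2)` is the exact power of 2 dividing `p + 1`, so `p`
determines `e`. -/
theorem labelPrimes_eq_of_mem {e e' p : ℕ} (h : p ∈ labelPrimes e) (h' : p ∈ labelPrimes e') :
    e = e' := by
  wlog hlt : e < e' generalizing e e'
  · rcases Nat.lt_trichotomy e e' with h1 | h1 | h1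
    · exact absurd h1 hlt
    · exact h1
    · exact (this h' h h1).symm
  exfalso
  obtain ⟨d, rfl⟩ := Nat.exists_eq_add_of_lt hlt
  have h1 : p % 2 ^ (e + d + 1 + 3) % 2 ^ (e + 3) = p % 2 ^ (e + 3) :=
    Nat.mod_mod_of_dvd p (pow_dvd_pow 2 (by omega))
  rw [h.2, h'.2] at h1
  have hx : 2 ^ (e + d + 1 + 2) = 2 ^ (e + 3) * 2 ^ d := by rw [← pow_add]; congr 1; omega
  have hpos : 0 < 2 ^ d := by positivity
  have hy : 2 ^ (e + 3) = 2 * 2 ^ (e + 2) := by rw [pow_succ]; ring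
  have hz : 0 < 2 ^ (e + 2) := by positivity
  obtain ⟨c, hc⟩ := Nat.exists_eq_add_of_lt hpos
  rw [hx, hc, show 2 ^ (e + 3) * (0 + c + 1) - 1 = (2 ^ (e + 3) - 1) + 2 ^ (e + 3) * c by
    rw [zero_add, mul_add, mul_one]; omega, Nat.add_mul_mod_self_left,
    Nat.mod_eq_of_lt (by omega)] at h1
  omega

/-! ## Partial substitutions of basis elements -/

section Push

variable {B B' B'' : Type*}

/-- The linear map induced by a partial map between the bases (undefined values go to `0`). -/
noncomputable def push (s : B → Option B') : (B →₀ ℚ) →ₗ[ℚ] (B' →₀ ℚ) :=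
  Finsupp.linearCombination ℚ fun b => (s b).elim 0 fun b' => Finsupp.single b' 1

theorem push_single (s : B → Option B') (b : B) (q : ℚ) :
    push s (Finsupp.single b q) = (s b).elim 0 fun b' => Finsupp.single b' q := by
  rw [push, Finsupp.linearCombination_single]
  cases s b <;> simp

theorem push_single_of_eq_some {s : B → Option B'} {b : B} {b' : B'} (h : s b = some b') (q : ℚ) :
    push s (Finsupp.single b q) = Finsupp.single b' q := by
  rw [push_single, h]; rfl

theorem push_single_of_eq_none {s : B → Option B'} {b : B} (h : s b = none) (q : ℚ) :
    push s (Finsupp.single b q) = 0 := by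
  rw [push_single, h]; rfl

theorem push_push (s : B → Option B') (t : B' → Option B'') (v : B →₀ ℚ) :
    push t (push s v) = push (fun b => (s b).bind t) v := by
  rw [← LinearMap.comp_apply]
  congr 1
  ext b : 2
  simp only [LinearMap.comp_apply, Finsupp.lsingle_apply, push_single]
  cases h : s b with
  | none => simp
  | some b' => simp [push_single]

open Classical in
theorem push_apply (s : B → Option B') (v : B →₀ ℚ) (b' : B') :
    push s v b' = ∑ b ∈ v.support, if s b = some b' then v b else 0 := by
  rw [push, Finsupp.linearCombination_apply, Finsupp.sum, Finsupp.finsetSum_apply]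
  refine Finset.sum_congr rfl fun b _ => ?_
  cases h : s b with
  | none => simp
  | some b'' =>
    by_cases hb : b'' = b'
    · subst hb; simp
    · simp [hb]

theorem exists_of_push_apply_ne_zero {s : B → Option B'} {v : B →₀ ℚ} {b' : B'}
    (h : push s v b' ≠ 0) : ∃ b, s b = some b' ∧ v b ≠ 0 := by
  classical
  rw [push_apply] at h
  obtain ⟨b, _, hb⟩ := Finset.exists_ne_zero_of_sum_ne_zero h
  by_cases hs : s b = some b'
  · exact ⟨b, hs, by rwa [if_pos hs] at hb⟩
  · exact absurd (if_neg hs) hb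

theorem push_apply_of_fiber {s : B → Option B'} {b' : B'} (S : Finset B)
    (hS : ∀ b, s b = some b' ↔ b ∈ S) (v : B →₀ ℚ) : push s v b' = ∑ b ∈ S, v b := by
  classical
  rw [push_apply]
  simp only [hS]
  rw [← Finset.sum_filter, Finset.filter_mem_eq_inter, Finset.inter_comm,
    ← Finset.filter_mem_eq_inter, Finset.sum_filter]
  refine Finset.sum_congr rfl fun b _ => ?_
  split_ifs with h
  · rfl
  · exact (Finsupp.notMem_support_iff.1 h).symm

theorem push_apply_of_unique {s : B → Option B'} {b' : B'} {b : B}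
    (hS : ∀ x, s x = some b' ↔ x = b) (v : B →₀ ℚ) : push s v b' = v b := by
  rw [push_apply_of_fiber {b} (by simpa using hS), Finset.sum_singleton]

theorem push_eq_self {s : B → Option B} {v : B →₀ ℚ} (h : ∀ b, v b ≠ 0 → s b = some b) :
    push s v = v := by
  conv_rhs => rw [← Finsupp.sum_single v]
  rw [push, Finsupp.linearCombination_apply]
  refine Finset.sum_congr rfl fun b hb => ?_
  simp [h b (Finsupp.mem_support_iff.1 hb)]

theorem integralAt_push {p : ℕ} (hp : p.Prime) (s : B → Option B') {v : B →₀ ℚ}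
    (h : ∀ b, IntegralAt p (v b)) (b' : B') : IntegralAt p (push s v b') := by
  classical
  rw [push_apply]
  refine IntegralAt.sum hp _ _ fun b _ => ?_
  split_ifs
  · exact h b
  · exact IntegralAt.zero hp

/-- The linear map that multiplies basis elements by scalars. -/
noncomputable def scale (c : B → ℚ) : (B →₀ ℚ) →ₗ[ℚ] (B →₀ ℚ) :=
  Finsupp.linearCombination ℚ fun b => Finsupp.single b (c b)

theorem scale_single (c : B → ℚ) (b : B) (q : ℚ) :
    scale c (Finsupp.single b q) = Finsupp.single b (c b * q) := by
  rw [scale, Finsupp.linearCombination_single, Finsupp.smul_single, smul_eq_mul, mul_comm]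

theorem scale_apply (c : B → ℚ) (v : B →₀ ℚ) (b : B) : scale c v b = c b * v b := by
  classical
  induction v using Finsupp.induction_linear with
  | zero => simp
  | add f g hf hg => simp [hf, hg, mul_add]
  | single a q =>
    rw [scale_single, Finsupp.single_apply, Finsupp.single_apply]
    split_ifs with h
    · rw [h]
    · simp

theorem push_scale {s : B → Option B'} {c : B → ℚ} {c' : B' → ℚ}
    (h : ∀ b b', s b = some b' → c' b' = c b) (v : B →₀ ℚ) :
    push s (scale c v) = scale c' (push s v) := by
  rw [← LinearMap.comp_apply, ← LinearMap.comp_apply]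
  congr 1
  ext b : 2
  simp only [LinearMap.comp_apply, Finsupp.lsingle_apply, push_single, scale_single]
  cases hb : s b with
  | none => simp
  | some b' => simp [scale_single, h b b' hb]

end Push

/-! ## Groups given by substitutions -/

section SubstGroup

variable {ι B : Type*} [Encodable ι]

/-- The group of all vectors whose image under the substitution with label `i` is integral at the
primes attached to `i`. So the kernel of that substitution becomes divisible by these primes. -/
def substGroup (s : ι → B → Option B) : AddSubgroup (B →₀ ℚ) where
  carrier := {v | ∀ i, ∀ p ∈ labelPrimes (Encodable.encode i), ∀ b, IntegralAt p (push (s i) v b)}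
  zero_mem' := fun i p hp b => by simpa using IntegralAt.zero hp.1
  add_mem' := fun {v w} hv hw i p hp b => by
    rw [map_add, Finsupp.add_apply]
    exact IntegralAt.add hp.1 (hv i p hp b) (hw i p hp b)
  neg_mem' := fun {v} hv i p hp b => by
    rw [map_neg, Finsupp.neg_apply]
    exact IntegralAt.neg (hv i p hp b)

variable {s : ι → B → Option B}

theorem mem_substGroup {v : B →₀ ℚ} : v ∈ substGroup s ↔
    ∀ i, ∀ p ∈ labelPrimes (Encodable.encode i), ∀ b, IntegralAt p (push (s i) v b) := Iff.rfl

theorem mem_substGroup_of_integralAt {v : B →₀ ℚ}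
    (h : ∀ p, p.Prime → ∀ b, IntegralAt p (v b)) : v ∈ substGroup s :=
  fun _ p hp => integralAt_push hp.1 _ (h p hp.1)

theorem single_mem_substGroup (b : B) : Finsupp.single b 1 ∈ substGroup s := by
  classical
  refine mem_substGroup_of_integralAt fun p hp b' => ?_
  rw [Finsupp.single_apply]
  split_ifs
  · exact IntegralAt.one hp
  · exact IntegralAt.zero hp

/-- The element of the group given by a basis vector. -/
noncomputable def basisElt (s : ι → B → Option B) (b : B) : substGroup s :=
  ⟨Finsupp.single b 1, single_mem_substGroup b⟩

/-- Primes attached to one label are units at the primes of all other labels. -/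
theorem integralAt_div_pow {p p' : ℕ} (hp : p.Prime) (hp' : p'.Prime) (hne : p ≠ p') {q : ℚ}
    (hq : IntegralAt p q) (j : ℕ) : IntegralAt p (((p' : ℚ) ^ j)⁻¹ * q) := by
  refine IntegralAt.mul hp ?_ hq
  have : IntegralAt p (((1 : ℤ) : ℚ) / ((p' ^ j : ℕ) : ℚ)) := by
    refine IntegralAt.div 1 fun hd => hne ?_
    exact (Nat.prime_dvd_prime_iff_eq hp hp').1 (hp.dvd_of_dvd_pow hd)
  simpa using this

/-- Endomorphisms preserve the kernels of the substitutions. -/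
theorem push_endo_eq_zero (φ : substGroup s →+ substGroup s) (i : ι) (a : substGroup s)
    (h : push (s i) (a : B →₀ ℚ) = 0) : push (s i) (φ a : B →₀ ℚ) = 0 := by
  obtain ⟨p, hp⟩ := labelPrimes_nonempty (Encodable.encode i)
  have hp0 : (p : ℚ) ≠ 0 := by exact_mod_cast hp.1.ne_zero
  ext b
  refine eq_zero_of_forall_integralAt_div_pow hp.1 fun j => ?_
  -- Division by powers of `p` stays in the group: label `i` only sees zero, and at the other labels
  -- `p` is a unit.
  have hmem : ((p : ℚ) ^ j)⁻¹ • (a : B →₀ ℚ) ∈ substGroup s := by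
    intro i' p' hp' b'
    rw [map_smul, Finsupp.smul_apply, smul_eq_mul]
    by_cases hii : i' = i
    · rw [hii, h]; simpa using IntegralAt.zero hp'.1
    · refine integralAt_div_pow hp'.1 hp.1 ?_ (a.2 i' p' hp' b') j
      rintro rfl
      exact hii (Encodable.encode_injective (labelPrimes_eq_of_mem hp' hp))
  have h1 : (p ^ j) • (⟨_, hmem⟩ : substGroup s) = a := by
    ext b'
    simp only [AddSubgroup.coe_nsmul, Finsupp.smul_apply, smul_eq_mul, nsmul_eq_mul]
    push_cast
    field_simp
  have h2 := (φ ⟨_, hmem⟩).2 i p hp b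
  have h3 : ((φ a : substGroup s) : B →₀ ℚ) = (p : ℚ) ^ j • (φ ⟨_, hmem⟩ : B →₀ ℚ) := by
    conv_lhs => rw [← h1, map_nsmul, AddSubgroup.coe_nsmul]
    ext b'
    simp
  rw [h3, map_smul, Finsupp.smul_apply, smul_eq_mul, mul_comm, mul_div_assoc, div_self (by positivity),
    mul_one]
  exact h2

/-- Every vector has a positive multiple with integral coordinates. -/
theorem exists_nsmul_integer (v : B →₀ ℚ) :
    ∃ N : ℕ, N ≠ 0 ∧ ∃ z : B →₀ ℤ, N • v = z.mapRange ((↑) : ℤ → ℚ) Int.cast_zero := by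
  classical
  refine ⟨∏ b ∈ v.support, (v b).den, Finset.prod_ne_zero_iff.2 fun b _ => (v b).den_ne_zero, ?_⟩
  refine ⟨Finsupp.onFinset v.support (fun b => (v b).num *
    ∏ b' ∈ v.support.erase b, ((v b').den : ℤ)) fun b hb => ?_, ?_⟩
  · rw [Finsupp.mem_support_iff]
    intro h0
    simp [h0] at hb
  · ext b
    by_cases hb : b ∈ v.support
    · rw [Finsupp.smul_apply, ← Finset.mul_prod_erase v.support _ hb]
      simp only [Finsupp.mapRange_apply, Finsupp.onFinset_apply, nsmul_eq_mul]
      push_cast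
      conv_lhs => rw [mul_right_comm, mul_comm ((v b).den : ℚ), Rat.mul_den_eq_num]
    · have hb0 := Finsupp.notMem_support_iff.1 hb
      simp [hb0]

/-- An endomorphism is determined by its values on the basis vectors. -/
theorem endo_eq_of_basis (φ : substGroup s →+ substGroup s) (Φ : (B →₀ ℚ) →ₗ[ℚ] (B →₀ ℚ))
    (h : ∀ b, (φ (basisElt s b) : B →₀ ℚ) = Φ (Finsupp.single b 1)) (a : substGroup s) :
    (φ a : B →₀ ℚ) = Φ a := by
  -- It suffices to treat integral vectors: every vector has a nonzero multiple of this kind, and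
  -- the target has no torsion.
  have key : ∀ z : B →₀ ℤ, ∀ hz : z.mapRange ((↑) : ℤ → ℚ) Int.cast_zero ∈ substGroup s,
      (φ ⟨_, hz⟩ : B →₀ ℚ) = Φ (z.mapRange ((↑) : ℤ → ℚ) Int.cast_zero) := by
    have hmem : ∀ z : B →₀ ℤ, z.mapRange ((↑) : ℤ → ℚ) Int.cast_zero ∈ substGroup s :=
      fun z => mem_substGroup_of_integralAt fun p hp b => by
        simpa using IntegralAt.intCast hp (z b)
    suffices H : ∀ z : B →₀ ℤ, (φ ⟨_, hmem z⟩ : B →₀ ℚ) =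
      Φ (z.mapRange ((↑) : ℤ → ℚ) Int.cast_zero) from fun z _ => H z
    intro z
    induction z using Finsupp.induction_linear with
    | zero =>
      have : (⟨_, hmem 0⟩ : substGroup s) = 0 := by ext; simp
      rw [this]; simp
    | add f g hf hg =>
      have h1 : (⟨_, hmem (f + g)⟩ : substGroup s) = ⟨_, hmem f⟩ + ⟨_, hmem g⟩ := by ext; simp
      have h2 : (f + g).mapRange ((↑) : ℤ → ℚ) Int.cast_zero =
        f.mapRange ((↑) : ℤ → ℚ) Int.cast_zero + g.mapRange ((↑) : ℤ → ℚ) Int.cast_zero := by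
          ext; simp
      rw [h1, map_add, AddSubgroup.coe_add, hf, hg, h2, map_add]
    | single b n =>
      have h1 : (⟨_, hmem (Finsupp.single b n)⟩ : substGroup s) = n • basisElt s b := by
        ext; simp [basisElt]
      have h2 : (Finsupp.single b n).mapRange ((↑) : ℤ → ℚ) Int.cast_zero =
        n • (Finsupp.single b (1 : ℚ)) := by simp
      rw [h1, map_zsmul, AddSubgroup.coe_zsmul, h, h2, map_zsmul]
  obtain ⟨N, hN, z, hz⟩ := exists_nsmul_integer (a : B →₀ ℚ)
  have hm : z.mapRange ((↑) : ℤ → ℚ) Int.cast_zero ∈ substGroup s := by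
    rw [← hz]; exact AddSubgroup.nsmul_mem _ a.2 N
  have h1 := key z hm
  have h2 : (⟨_, hm⟩ : substGroup s) = N • a := by ext1; exact hz.symm
  rw [h2, map_nsmul, AddSubgroup.coe_nsmul, ← hz, map_nsmul] at h1
  exact nsmul_right_injective hN h1

/-- A partial map of the basis that is compatible with all substitutions preserves the group. -/
theorem push_mem_substGroup (g : B → Option B)
    (hn : ∀ i b, s i b = none → (g b).bind (s i) = none)
    (hs : ∀ i b b', s i b = some b' → (g b).bind (s i) = (g b').bind (s i))
    {v : B →₀ ℚ} (hv : v ∈ substGroup s) : push g v ∈ substGroup s := by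
  intro i p hp b
  rw [push_push]
  -- The hypotheses say that `g` followed by `s i` factors through `s i`, so integrality after `s i`
  -- is enough.
  have : (fun b => (g b).bind (s i)) = fun b => (s i b).bind fun b' => (g b').bind (s i) := by
    funext b
    cases h : s i b with
    | none => exact hn i b h
    | some b' => exact hs i b b' h
  rw [this, ← push_push]
  exact integralAt_push hp.1 _ (hv i p hp) b

end SubstGroup

/-! ## The group attached to a labelled tree -/

/-- Basis elements: `x_{k,a,l}` for a node `l` of the full tree of finite sequences (last entry
first) and `y_{k,n}` for a level `n`. -/
abbrev TreeBasis : Type := (ℕ × ℕ × List ℕ) ⊕ (ℕ × ℕ)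

/-- Labels: the levels, the edges below a level, and the lines through `x_{k,a,l} - y_{k,|l|}`. -/
abbrev TreeLabel : Type := ℕ ⊕ ℕ ⊕ (ℕ × ℕ × List ℕ)

/-- The substitutions that define the group attached to a set of live nodes. -/
def treeSubst (live : List ℕ → Bool) : TreeLabel → TreeBasis → Option TreeBasis
  | .inl n, .inl t => if t.2.2.length = n ∧ live t.2.2 = true then none else some (.inl t)
  | .inl n, .inr y => if y.2 = n then none else some (.inr y)
  | .inr (.inl n), .inl t =>
      if t.2.2.length = n + 1 then some (.inl (t.1, t.2.1, t.2.2.tail)) else some (.inl t)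
  | .inr (.inl _), .inr y => some (.inr y)
  | .inr (.inr t), .inl t' => if t' = t then some (.inr (t.1, t.2.2.length)) else some (.inl t')
  | .inr (.inr _), .inr y => some (.inr y)

/-- The group attached to a set of live nodes. -/
abbrev treeGroup (live : List ℕ → Bool) : AddSubgroup (TreeBasis →₀ ℚ) :=
  substGroup (treeSubst live)

/-- The component of a basis element. -/
def TreeBasis.component : TreeBasis → ℕ
  | .inl t => t.1
  | .inr y => y.1

/-- The level of a basis element. -/
def TreeBasis.level : TreeBasis → ℕ
  | .inl t => t.2.2.length
  | .inr y => y.2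

/-- A set of live nodes has a path if it contains a sequence of nodes, each of which is a child
of the previous one. -/
def HasPath (live : List ℕ → Bool) : Prop :=
  ∃ σ : ℕ → List ℕ, ∀ i, live (σ i) = true ∧ ∃ x, σ (i + 1) = x :: σ i

/-- This is why scaling each component by its own scalar commutes with all substitutions. -/
theorem treeSubst_component {live : List ℕ → Bool} {i : TreeLabel} {b b' : TreeBasis}
    (h : treeSubst live i b = some b') : b'.component = b.component := by
  rcases i with n | n | t <;> rcases b with t' | y <;> simp only [treeSubst] at h <;>
    (try split_ifs at h with hc) <;> simp only [Option.some.injEq] at h <;> subst h <;>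
    simp_all [TreeBasis.component]

/-- The multiplication of the components of the group by scalars. -/
noncomputable def componentScale (live : List ℕ → Bool) (c : ℕ → ℚ)
    (hc : ∀ k, ∀ i : TreeLabel, ∀ p ∈ labelPrimes (Encodable.encode i), IntegralAt p (c k)) :
    treeGroup live →+ treeGroup live :=
  ((scale fun b : TreeBasis => c b.component).toAddMonoidHom.comp
    (treeGroup live).subtype).codRestrict (treeGroup live) fun v i p hp b => by
      change IntegralAt p (push (treeSubst live i) (scale _ (v : TreeBasis →₀ ℚ)) b)
      rw [push_scale (c' := fun b : TreeBasis => c b.component)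
        (fun b b' h => by rw [treeSubst_component h]), scale_apply]
      exact IntegralAt.mul hp.1 (hc _ i p hp) (v.2 i p hp b)

theorem componentScale_apply {live : List ℕ → Bool} {c : ℕ → ℚ} {hc} (v : treeGroup live)
    (b : TreeBasis) :
    (componentScale live c hc v : TreeBasis →₀ ℚ) b = c b.component * (v : TreeBasis →₀ ℚ) b :=
  scale_apply _ _ _

/-! ### Endomorphisms of the tree group and their rigidity without a path -/

section Rigid

variable {live : List ℕ → Bool} (φ : treeGroup live →+ treeGroup live)

/-- The image of a basis vector under an endomorphism. -/
noncomputable def endoBasis (b : TreeBasis) : TreeBasis →₀ ℚ := (φ (basisElt _ b) : TreeBasis →₀ ℚ)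

theorem push_endoBasis_eq_zero {i : TreeLabel} {b : TreeBasis} (h : treeSubst live i b = none) :
    push (treeSubst live i) (endoBasis φ b) = 0 :=
  push_endo_eq_zero φ i _ (push_single_of_eq_none h 1)

theorem push_endoBasis_sub_eq_zero {i : TreeLabel} {b b' : TreeBasis}
    (h : treeSubst live i b = treeSubst live i b') :
    push (treeSubst live i) (endoBasis φ b - endoBasis φ b') = 0 := by
  have := push_endo_eq_zero φ i (basisElt _ b - basisElt _ b') (by
    rw [AddSubgroup.coe_sub, map_sub, sub_eq_zero]
    change push _ (Finsupp.single b 1) = push _ (Finsupp.single b' 1)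
    rw [push_single, push_single, h])
  rwa [map_sub, AddSubgroup.coe_sub] at this

/-- The image of `y_{k,n}` is supported in the live part of level `n`. -/
theorem level_of_endoBasis_inr {k n : ℕ} {b : TreeBasis} (h : endoBasis φ (.inr (k, n)) b ≠ 0) :
    b.level = n ∧ ∀ t, b = .inl t → live t.2.2 = true := by
  have h0 := push_endoBasis_eq_zero φ (i := .inl n) (b := .inr (k, n)) (by simp [treeSubst])
  -- A basis element outside the kernel is fixed by the level substitution and is hit by nothing
  -- else, so its coefficient survives.
  by_contra hb
  have hs : treeSubst live (.inl n) b = some b := by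
    rcases b with t | y
    · simp only [treeSubst]
      rw [if_neg]
      rintro ⟨h1, h2⟩
      exact hb ⟨h1, fun t' ht' => by cases ht'; exact h2⟩
    · simp only [treeSubst]
      rw [if_neg]
      intro h1
      exact hb ⟨h1, fun t' ht' => by cases ht'⟩
  apply h
  rw [← push_apply_of_unique (s := treeSubst live (.inl n)) (b' := b) (b := b), h0]
  · rfl
  · intro x
    constructor
    · intro hx
      rcases x with t | y <;> simp only [treeSubst] at hx <;> split_ifs at hx <;>
        exact Option.some.inj hx
    · rintro rfl; exact hs

/-- The coefficient of `φ` at a node. -/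
noncomputable def nodeCoeff (t : ℕ × ℕ × List ℕ) : ℚ :=
  (endoBasis φ (.inl t) - endoBasis φ (.inr (t.1, t.2.2.length))) (.inl t)

/-- The kernel of the substitution for the line of `t` is one-dimensional, spanned by
$x_t-y_{k,|t|}$, and contains the difference of the two images. -/
theorem endoBasis_inl (t : ℕ × ℕ × List ℕ) :
    endoBasis φ (.inl t) = nodeCoeff φ t • (Finsupp.single (.inl t) 1 -
      Finsupp.single (.inr (t.1, t.2.2.length)) 1) + endoBasis φ (.inr (t.1, t.2.2.length)) := by
  classical
  rw [← sub_eq_iff_eq_add]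
  have h0 := push_endoBasis_sub_eq_zero φ (i := .inr (.inr t)) (b := .inl t)
    (b' := .inr (t.1, t.2.2.length)) (by simp [treeSubst])
  set v := endoBasis φ (.inl t) - endoBasis φ (.inr (t.1, t.2.2.length)) with hv
  have hc : nodeCoeff φ t = v (.inl t) := rfl
  rw [hc]
  ext b
  by_cases hx : b = .inl t
  · subst hx; simp
  by_cases hy : b = .inr (t.1, t.2.2.length)
  · subst hy
    have := push_apply_of_fiber (s := treeSubst live (.inr (.inr t)))
      (b' := .inr (t.1, t.2.2.length)) {.inl t, .inr (t.1, t.2.2.length)} (fun b => by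
        rcases b with t' | y <;> simp only [treeSubst]
        · split_ifs with h <;> simp [h]
        · simp) v
    rw [h0, Finset.sum_pair (by simp)] at this
    simp only [Finsupp.coe_zero, Pi.zero_apply] at this
    simp
    linarith
  · have := push_apply_of_unique (s := treeSubst live (.inr (.inr t))) (b' := b) (b := b)
      (fun b' => by
        rcases b' with t' | y <;> simp only [treeSubst]
        · split_ifs with h
          · subst h
            simp only [Option.some.injEq]
            exact ⟨fun h1 => absurd h1.symm hy, fun h1 => absurd h1.symm hx⟩
          · simp
        · simp) v
    rw [h0] at this
    simp [← this, Ne.symm hx, Ne.symm hy]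

/-- The relation between the values of `φ` at the two ends of an edge, before taking
coefficients. -/
theorem edge_relation (k a x : ℕ) (l : List ℕ) (b : TreeBasis) :
    nodeCoeff φ (k, a, x :: l) * ((if b = .inl (k, a, l) then 1 else 0) -
        (if b = .inr (k, l.length + 1) then 1 else 0)) +
      push (treeSubst live (.inr (.inl l.length))) (endoBasis φ (.inr (k, l.length + 1))) b =
    nodeCoeff φ (k, a, l) * ((if b = .inl (k, a, l) then 1 else 0) -
        (if b = .inr (k, l.length) then 1 else 0)) + endoBasis φ (.inr (k, l.length)) b := by
  classical
  have h0 := push_endoBasis_sub_eq_zero φ (i := .inr (.inl l.length)) (b := .inl (k, a, x :: l))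
    (b' := .inl (k, a, l)) (by simp [treeSubst])
  -- The edge substitution moves only nodes of level `l.length + 1`, while this image lives in level
  -- `l.length`.
  have hself : push (treeSubst live (.inr (.inl l.length))) (endoBasis φ (.inr (k, l.length))) =
      endoBasis φ (.inr (k, l.length)) := by
    refine push_eq_self fun b hb => ?_
    have hl := (level_of_endoBasis_inr φ hb).1
    rcases b with t | y
    · change t.2.2.length = l.length at hl
      simp [treeSubst, hl]
    · rfl
  rw [map_sub, sub_eq_zero, endoBasis_inl, endoBasis_inl φ (k, a, l)] at h0
  simp only [map_add, map_smul, map_sub, hself, List.length_cons] at h0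
  rw [push_single_of_eq_some (b' := .inl (k, a, l)) (by simp [treeSubst]),
    push_single_of_eq_some (b' := .inr (k, l.length + 1)) (by simp [treeSubst]),
    push_single_of_eq_some (b' := .inl (k, a, l)) (by simp [treeSubst]),
    push_single_of_eq_some (b' := .inr (k, l.length)) (by simp [treeSubst])] at h0
  have h1 := DFunLike.congr_fun h0 b
  simpa [Finsupp.single_apply, eq_comm] using h1

theorem push_edge_inr (n : ℕ) (v : TreeBasis →₀ ℚ) (y : ℕ × ℕ) :
    push (treeSubst live (.inr (.inl n))) v (.inr y) = v (.inr y) := by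
  refine push_apply_of_unique (fun b => ?_) v
  rcases b with t | y'
  · simp only [treeSubst]; split_ifs <;> simp
  · simp [treeSubst]

theorem endoBasis_inr_eq_zero_of_level_ne {k n : ℕ} {b : TreeBasis} (h : b.level ≠ n) :
    endoBasis φ (.inr (k, n)) b = 0 := by
  by_contra h0
  exact h (level_of_endoBasis_inr φ h0).1

/-- Compare coefficients of $y_{k,|l|}$ in the edge relation: on the side of the child nothing
contributes, because everything from $\varphi(y_{k,|l|+1})$ has the wrong level. -/
theorem nodeCoeff_eq (k a : ℕ) (l : List ℕ) :
    nodeCoeff φ (k, a, l) = endoBasis φ (.inr (k, l.length)) (.inr (k, l.length)) := by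
  have h := edge_relation φ k a 0 l (.inr (k, l.length))
  rw [push_edge_inr, endoBasis_inr_eq_zero_of_level_ne φ (by simp [TreeBasis.level])] at h
  simp at h
  linarith

theorem endoBasis_inr_inr_of_ne {k k' n m : ℕ} (h : (k', m) ≠ (k, n)) :
    endoBasis φ (.inr (k, n)) (.inr (k', m)) = 0 := by
  by_cases hm : m = n
  · subst hm
    have hk : k' ≠ k := fun hk => h (by rw [hk])
    have h1 := edge_relation φ k 0 0 (List.replicate m 0) (.inr (k', m))
    rw [push_edge_inr, List.length_replicate,
      endoBasis_inr_eq_zero_of_level_ne φ (by simp [TreeBasis.level])] at h1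
    simp [hk] at h1
    exact h1.symm
  · exact endoBasis_inr_eq_zero_of_level_ne φ hm

/-- This compatibility between consecutive levels produces the path. It is the edge relation read at
a node where the scalar terms vanish. -/
theorem push_edge_endoBasis (k : ℕ) (t : ℕ × ℕ × List ℕ) :
    push (treeSubst live (.inr (.inl t.2.2.length))) (endoBasis φ (.inr (k, t.2.2.length + 1)))
      (.inl t) = endoBasis φ (.inr (k, t.2.2.length)) (.inl t) := by
  -- The edge is taken in a copy of the tree other than the one containing `t`; this is the purpose
  -- of the index $a$.
  have h := edge_relation φ k (t.2.1 + 1) 0 t.2.2 (.inl t)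
  have hne : t ≠ (k, t.2.1 + 1, t.2.2) := fun h => by
    have := congrArg (fun t => t.2.1) h
    simp at this
  simpa [hne] using h

theorem nodeCoeff_cons (k a x : ℕ) (l : List ℕ) :
    nodeCoeff φ (k, a, x :: l) = nodeCoeff φ (k, a, l) := by
  have h := edge_relation φ k a x l (.inl (k, a, l))
  have h1 := push_edge_endoBasis φ k (k, a, l)
  simp only at h1
  rw [h1] at h
  simpa using h

/-- The scalar by which `φ` acts on a component. -/
noncomputable def componentCoeff (k : ℕ) : ℚ := nodeCoeff φ (k, 0, [])

theorem endoBasis_inr_self (k n : ℕ) :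
    endoBasis φ (.inr (k, n)) (.inr (k, n)) = componentCoeff φ k := by
  have h : nodeCoeff φ (k, 0, List.replicate n 0) = componentCoeff φ k := by
    induction n with
    | zero => rfl
    | succ n ih => rw [List.replicate_succ, nodeCoeff_cons, ih]
  rw [← h, nodeCoeff_eq, List.length_replicate]

/-- If there is no path, then `φ` maps `y_{k,n}` to no combination that involves nodes. -/
theorem endoBasis_inr_inl (hp : ¬ HasPath live) (k n : ℕ) (t : ℕ × ℕ × List ℕ) :
    endoBasis φ (.inr (k, n)) (.inl t) = 0 := by
  by_contra h0
  obtain rfl : t.2.2.length = n := (level_of_endoBasis_inr φ h0).1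
  obtain ⟨k', a', l'⟩ := t
  -- Nodes at which a coefficient is nonzero: all are live, and each has a child of the same kind,
  -- so iterating gives a path.
  let N := {l : List ℕ // endoBasis φ (.inr (k, l.length)) (.inl (k', a', l)) ≠ 0}
  have hstep : ∀ l : N, ∃ l'' : N, ∃ x, l''.1 = x :: l.1 := by
    rintro ⟨l, hl⟩
    have h1 := push_edge_endoBasis φ k (k', a', l)
    simp only at h1
    rw [← h1] at hl
    obtain ⟨b, hb, hb0⟩ := exists_of_push_apply_ne_zero hl
    have hlev := (level_of_endoBasis_inr φ hb0).1
    rcases b with ⟨k1, a1, l1⟩ | y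
    · change l1.length = l.length + 1 at hlev
      simp only [treeSubst, hlev, if_true, Option.some.injEq, Sum.inl.injEq, Prod.mk.injEq] at hb
      obtain ⟨rfl, rfl, rfl⟩ := hb
      cases l1 with
      | nil => simp at hlev
      | cons x l2 => exact ⟨⟨x :: l2, hb0⟩, x, rfl⟩
    · simp [treeSubst] at hb
  choose next hnext using hstep
  refine hp ⟨fun i => (next^[i] ⟨l', h0⟩).1, fun i => ⟨?_, ?_⟩⟩
  · exact (level_of_endoBasis_inr φ (next^[i] ⟨l', h0⟩).2).2 _ rfl
  · simp only [Function.iterate_succ_apply']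
    exact hnext _

theorem endoBasis_eq (hp : ¬ HasPath live) (b : TreeBasis) :
    endoBasis φ b = Finsupp.single b (componentCoeff φ b.component) := by
  have hy : ∀ k n, endoBasis φ (.inr (k, n)) =
      Finsupp.single (.inr (k, n)) (componentCoeff φ k) := fun k n => by
    classical
    ext b
    rcases b with t | ⟨k', m⟩
    · rw [endoBasis_inr_inl φ hp]; simp
    · by_cases h : (k', m) = (k, n)
      · rw [h, endoBasis_inr_self]; simp
      · rw [endoBasis_inr_inr_of_ne φ h, Finsupp.single_eq_of_ne (by simpa using h)]
  rcases b with ⟨k, a, l⟩ | ⟨k, n⟩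
  · rw [endoBasis_inl, hy, nodeCoeff_eq, endoBasis_inr_self]
    ext b
    simp [TreeBasis.component, mul_sub, Finsupp.single_apply]
  · exact hy k n

theorem endo_apply (hp : ¬ HasPath live) (v : treeGroup live) (b : TreeBasis) :
    (φ v : TreeBasis →₀ ℚ) b = componentCoeff φ b.component * (v : TreeBasis →₀ ℚ) b := by
  rw [endo_eq_of_basis φ (scale fun b : TreeBasis => componentCoeff φ b.component)
    (fun b => by rw [scale_single, mul_one]; exact endoBasis_eq φ hp b), scale_apply]

/-- Apply `φ` to some $y_{k,m}$ that the substitution does not kill; the scalar is then a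
coefficient of the image. -/
theorem integralAt_componentCoeff (hp : ¬ HasPath live) (k : ℕ) (i : TreeLabel) (p : ℕ)
    (hpi : p ∈ labelPrimes (Encodable.encode i)) : IntegralAt p (componentCoeff φ k) := by
  obtain ⟨m, b', hm⟩ : ∃ m b', treeSubst live i (.inr (k, m)) = some b' := by
    rcases i with n | n | t
    -- The level substitution for `n` kills only level `n`, so any other level serves.
    · exact ⟨n + 1, _, by simp only [treeSubst]; rw [if_neg (by omega)]⟩
    · exact ⟨0, _, rfl⟩
    · exact ⟨0, _, rfl⟩
  have h := (φ (basisElt _ (.inr (k, m)))).2 i p hpi b'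
  have h1 : (φ (basisElt _ (.inr (k, m))) : TreeBasis →₀ ℚ) = _ := endoBasis_eq φ hp (.inr (k, m))
  rw [h1, push_single_of_eq_some hm, Finsupp.single_eq_same] at h
  exact h

end Rigid

/-- If there is no path, the group attached to the live nodes is cancellable. -/
theorem isCancellable_treeGroup {live : List ℕ → Bool} (hp : ¬ HasPath live) :
    IsCancellable.{u} (treeGroup live) := by
  refine EndStableRangeOne.isCancellable fun f f' g h => ?_
  let W : Set ℕ := {p | ∃ i : TreeLabel, p ∈ labelPrimes (Encodable.encode i)}
  have hW : ∀ p ∈ W, p.Prime ∧ p % 4 = 3 := by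
    rintro p ⟨i, hi⟩
    exact ⟨hi.1, mod_four_of_mem_labelPrimes hi⟩
  have hint : ∀ φ : treeGroup live →+ treeGroup live, ∀ k, ∀ p ∈ W,
      IntegralAt p (componentCoeff φ k) := by
    rintro φ k p ⟨i, hi⟩
    exact integralAt_componentCoeff φ hp k i p hi
  have hrel : ∀ k, componentCoeff f k * componentCoeff f' k + componentCoeff g k = 1 := fun k => by
    have h1 := congrArg (fun v : treeGroup live => (v : TreeBasis →₀ ℚ) (.inr (k, 0)))
      (h (basisElt _ (.inr (k, 0))))
    simp only [AddSubgroup.coe_add, Finsupp.add_apply, endo_apply _ hp] at h1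
    simpa [basisElt, TreeBasis.component] using h1
  -- Endomorphisms act as independent scalars on the components, so stable range one may be checked
  -- on each component separately.
  choose x hx hx0 hxi using fun k =>
    exists_unit_of_mul_add_eq_one hW (hint f k) (hint f' k) (hint g k) (hrel k)
  refine ⟨componentScale live x fun k i p hpi => hx k p ⟨i, hpi⟩, ?_⟩
  rw [Function.bijective_iff_has_inverse]
  refine ⟨componentScale live _ fun k i p hpi => hxi k p ⟨i, hpi⟩, fun v => ?_, fun v => ?_⟩
  · ext b
    rw [componentScale_apply, AddSubgroup.coe_add, Finsupp.add_apply, endo_apply f hp,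
      endo_apply g hp, componentScale_apply]
    have := hx0 b.component
    field_simp
  · ext b
    rw [AddSubgroup.coe_add, Finsupp.add_apply, endo_apply f hp, endo_apply g hp]
    simp only [componentScale_apply]
    have := hx0 b.component
    field_simp

/-! ### The case of a path -/

/-- The map of basis elements that sends component `k` to the copy of the path `σ` in component
`κ k`. -/
def pathMap (κ : ℕ → Option ℕ) (σ : ℕ → List ℕ) (b : TreeBasis) : Option TreeBasis :=
  (κ b.component).map fun k => .inl (k, 0, σ b.level)

/-- Compatibility with each kind of label: level kernels go to level kernels because the path is
live, edges go to edges of the path because it descends node by node, and the two ends of a line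
have the same image because they share component and level. -/
theorem push_pathMap_mem {live : List ℕ → Bool} {σ : ℕ → List ℕ}
    (hσ : ∀ n, live (σ n) = true) (hlen : ∀ n, (σ n).length = n)
    (htail : ∀ n, (σ (n + 1)).tail = σ n) (κ : ℕ → Option ℕ) {v : TreeBasis →₀ ℚ}
    (hv : v ∈ treeGroup live) : push (pathMap κ σ) v ∈ treeGroup live := by
  refine push_mem_substGroup _ (fun i b h => ?_) (fun i b b' h => ?_) hv
  · rcases i with n | n | t
    · have hb : b.level = n := by
        rcases b with t | y <;> simp only [treeSubst] at h <;> split_ifs at h with hc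
        · exact hc.1
        · exact hc
      simp only [pathMap, hb]
      cases κ b.component with
      | none => rfl
      | some k => simp [treeSubst, hσ, hlen]
    · rcases b with t | y <;> simp only [treeSubst] at h <;> try split_ifs at h
      cases h
    · rcases b with t | y <;> simp only [treeSubst] at h <;> try split_ifs at h
      cases h
  · have hc := treeSubst_component h
    simp only [pathMap, hc]
    cases κ b.component with
    | none => rfl
    | some k =>
      simp only [Option.map_some, Option.bind_some]
      by_cases hl : b'.level = b.level
      · rw [hl]
      rcases i with n | n | t
      · rcases b with t | y <;> simp only [treeSubst] at h <;> split_ifs at h <;>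
          simp only [Option.some.injEq] at h <;> exact absurd (by rw [h]) hl
      · rcases b with t | y <;> simp only [treeSubst] at h
        · split_ifs at h with ht
          · simp only [Option.some.injEq] at h
            subst h
            simp [TreeBasis.level, ht, treeSubst, hlen, htail]
          · simp only [Option.some.injEq] at h
            exact absurd (by rw [h]) hl
        · simp only [Option.some.injEq] at h
          exact absurd (by rw [h]) hl
      · rcases b with t' | y <;> simp only [treeSubst] at h
        · split_ifs at h with ht
          · simp only [Option.some.injEq] at h
            subst h ht
            exact absurd rfl hl
          · simp only [Option.some.injEq] at h
            exact absurd (by rw [h]) hl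
        · simp only [Option.some.injEq] at h
          exact absurd (by rw [h]) hl

/-- The endomorphism that moves the copies of the path `σ` along the partial map `κ` of components
and is the identity on a complement of the copies of `σ`. -/
noncomputable def pathShift {live : List ℕ → Bool} {σ : ℕ → List ℕ}
    (hσ : ∀ n, live (σ n) = true) (hlen : ∀ n, (σ n).length = n)
    (htail : ∀ n, (σ (n + 1)).tail = σ n) (κ : ℕ → Option ℕ) : treeGroup live →+ treeGroup live :=
  ((LinearMap.id - push (pathMap some σ) + push (pathMap κ σ)).toAddMonoidHom.comp
    (treeGroup live).subtype).codRestrict (treeGroup live) fun v =>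
      add_mem (sub_mem v.2 (push_pathMap_mem hσ hlen htail some v.2))
        (push_pathMap_mem hσ hlen htail κ v.2)

/-- If there is a path, the group attached to the live nodes is not cancellable. -/
theorem not_isCancellable_treeGroup {live : List ℕ → Bool} {σ : ℕ → List ℕ}
    (hσ : ∀ n, live (σ n) = true) (hlen : ∀ n, (σ n).length = n)
    (htail : ∀ n, (σ (n + 1)).tail = σ n) : ¬ IsCancellable.{u} (treeGroup live) := by
  -- Component 0 has no predecessor: its copy of the path spans what the left inverse kills.
  let pred : ℕ → Option ℕ := fun k => if k = 0 then none else some (k - 1)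
  refine not_isCancellable_of_leftInverse (pathShift hσ hlen htail fun k => some (k + 1))
    (pathShift hσ hlen htail pred) (fun v => ?_) (basisElt _ (.inl (0, 0, σ 0))) ?_ ?_
  · have h : (LinearMap.id - push (pathMap some σ) + push (pathMap pred σ)).comp
        (LinearMap.id - push (pathMap some σ) + push (pathMap (fun k => some (k + 1)) σ)) =
        LinearMap.id := by
      ext b : 2
      have e : ∀ κ b, pathMap κ σ b = (κ b.component).map fun k => .inl (k, 0, σ b.level) :=
        fun _ _ => rfl
      have e' : ∀ k, TreeBasis.component (.inl (k, 0, σ b.level)) = k := fun _ => rfl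
      have e'' : ∀ k, TreeBasis.level (.inl (k, 0, σ b.level)) = b.level := fun _ => hlen _
      simp only [LinearMap.comp_apply, Finsupp.lsingle_apply, LinearMap.add_apply,
        LinearMap.sub_apply, LinearMap.id_apply, map_add, map_sub, push_single, e, e', e'',
        Option.map_some, Option.elim_some, pred, Nat.add_one_sub_one, Nat.succ_ne_zero, if_false]
      abel
    exact Subtype.ext (LinearMap.congr_fun h v)
  · refine Subtype.ext ?_
    change (LinearMap.id - push (pathMap some σ) + push (pathMap pred σ) :
      (TreeBasis →₀ ℚ) →ₗ[ℚ] (TreeBasis →₀ ℚ)) (Finsupp.single (.inl (0, 0, σ 0)) 1) = 0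
    simp [push_single, pathMap, TreeBasis.component, TreeBasis.level, hlen, pred]
  · intro h
    have := congrArg (fun v : treeGroup live => (v : TreeBasis →₀ ℚ) (.inl (0, 0, σ 0))) h
    simp [basisElt] at this

/-! ## Relative computability -/

section ComputableIn

open Encodable

variable {α β γ σ : Type*} [Primcodable α] [Primcodable β] [Primcodable γ] [Primcodable σ]
  {O : Set (ℕ →. ℕ)}

theorem ComputableIn.comp {f : β → σ} {g : α → β} (hf : ComputableIn O f)
    (hg : ComputableIn O g) : ComputableIn O fun a => f (g a) := by
  have h := Nat.RecursiveIn.comp hf hg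
  refine Nat.RecursiveIn.of_eq h fun n => ?_
  cases e : decode (α := α) n with
  | none => simp
  | some a => simp [encodek]

theorem ComputableIn.pair {f : α → β} {g : α → γ} (hf : ComputableIn O f)
    (hg : ComputableIn O g) : ComputableIn O fun a => (f a, g a) := by
  have h := Nat.RecursiveIn.pair hf hg
  refine Nat.RecursiveIn.of_eq h fun n => ?_
  cases e : decode (α := α) n with
  | none => simp [Seq.seq]
  | some a => simp [Seq.seq]

theorem Primrec.comp_computableIn {f : β → σ} {g : α → β} (hf : Primrec f)
    (hg : ComputableIn O g) : ComputableIn O fun a => f (g a) :=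
  hf.computableIn.comp hg

theorem Primrec₂.comp_computableIn {f : β → γ → σ} {g : α → β} {h : α → γ} (hf : Primrec₂ f)
    (hg : ComputableIn O g) (hh : ComputableIn O h) : ComputableIn O fun a => f (g a) (h a) :=
  Primrec.comp_computableIn (f := fun p : β × γ => f p.1 p.2) hf (hg.pair hh)

theorem ComputableIn.cond {c : α → Bool} {f g : α → σ} (hc : ComputableIn O c)
    (hf : ComputableIn O f) (hg : ComputableIn O g) :
    ComputableIn O fun a => bif c a then f a else g a :=
  Primrec.comp_computableIn (f := fun p : Bool × σ × σ => bif p.1 then p.2.1 else p.2.2)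
    (Primrec.cond Primrec.fst (Primrec.fst.comp Primrec.snd) (Primrec.snd.comp Primrec.snd))
    (hc.pair (hf.pair hg))

theorem ComputableIn.nat_rec {f : ℕ → ℕ} {h : ℕ × ℕ × ℕ → ℕ} (hf : ComputableIn O f)
    (hh : ComputableIn O h) :
    ComputableIn O fun p : ℕ × ℕ => Nat.rec (motive := fun _ => ℕ) (f p.1)
      (fun y i => h (p.1, y, i)) p.2 := by
  have h1 := Nat.RecursiveIn.prec (RecursiveIn.iff_nat.1 hf) hh
  refine Nat.RecursiveIn.of_eq h1 fun n => ?_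
  simp only [Part.coe_some, Nat.unpair_pair, Encodable.decode_prod_val, Encodable.decode_nat,
    Option.map_some, Option.bind_some, Part.bind_some, Part.map_some, Encodable.encode_nat]
  induction n.unpair.2 with
  | zero => rfl
  | succ k ih =>
    change Part.bind _ _ = _
    rw [ih, Part.bind_some]

/-- The list of the first values of a function computable in an oracle. -/
theorem ComputableIn.map_range {f : ℕ × ℕ → ℕ} (hf : ComputableIn O f) :
    ComputableIn O fun p : ℕ × ℕ => (List.range p.2).map fun i => f (p.1, i) := by
  have step : ComputableIn O fun t : ℕ × ℕ × ℕ =>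
      encode (((decode (α := List ℕ) t.2.2).getD []) ++ [f (t.1, t.2.1)]) := by
    refine Primrec.comp_computableIn (g := fun t : ℕ × ℕ × ℕ => (t.2.2, f (t.1, t.2.1)))
      (f := fun q : ℕ × ℕ => encode (((decode (α := List ℕ) q.1).getD []) ++ [q.2])) ?_ ?_
    · exact Primrec.encode.comp (Primrec.list_append.comp
        (Primrec.option_getD.comp (Primrec.decode.comp Primrec.fst) (Primrec.const []))
        (Primrec.list_cons.comp Primrec.snd (Primrec.const [])))
    · exact (Primrec.snd.comp Primrec.snd).computableIn.pair
        (hf.comp (Primrec.pair Primrec.fst (Primrec.fst.comp Primrec.snd)).computableIn)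
  have h1 := ComputableIn.nat_rec (ComputableIn.const (encode ([] : List ℕ))) step
  have h2 : ∀ p : ℕ × ℕ, Nat.rec (motive := fun _ => ℕ) (encode ([] : List ℕ))
      (fun y i => encode (((decode (α := List ℕ) i).getD []) ++ [f (p.1, y)])) p.2 =
      encode ((List.range p.2).map fun i => f (p.1, i)) := by
    rintro ⟨a, n⟩
    induction n with
    | zero => rfl
    | succ n ih =>
      simp only at ih ⊢
      rw [ih, encodek, List.range_succ, List.map_append]
      rfl
  have h3 := Primrec.comp_computableIn (f := fun n : ℕ => (decode (α := List ℕ) n).getD [])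
    (Primrec.option_getD.comp Primrec.decode (Primrec.const [])) h1
  simp only [h2, encodek, Option.getD_some] at h3
  exact h3

end ComputableIn

/-! ## A normal form for `Π¹₁` sets -/

/-- The first `m` values of a function. -/
def initSeg (h : ℕ → ℕ) (m : ℕ) : List ℕ := (List.range m).map h

@[simp] theorem length_initSeg (h : ℕ → ℕ) (m : ℕ) : (initSeg h m).length = m := by
  simp [initSeg]

theorem getD_initSeg (h : ℕ → ℕ) {m i : ℕ} (hi : i < m) : (initSeg h m).getD i 0 = h i := by
  simp [initSeg, hi]

theorem take_initSeg (h : ℕ → ℕ) {m j : ℕ} (hj : j ≤ m) :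
    (initSeg h m).take j = initSeg h j := by
  rw [initSeg, initSeg, ← List.map_take, List.take_range, min_eq_left hj]

/-- Relations of the form "every initial segment of `h` passes a test that is decidable in `X`". -/
def ClosedIn (X : ℕ → ℕ) (K : (ℕ → ℕ) → ℕ → Prop) : Prop :=
  ∃ c : ℕ × List ℕ → Bool, ComputableIn {(X : ℕ →. ℕ)} c ∧
    ∀ h n, K h n ↔ ∀ m, c (n, initSeg h m) = true

section Closed

variable {X : ℕ → ℕ} {K K' : (ℕ → ℕ) → ℕ → Prop}

theorem ClosedIn.const {c : ℕ → Bool} (hc : ComputableIn {(X : ℕ →. ℕ)} c) :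
    ClosedIn X fun _ n => c n = true :=
  ⟨fun p => c p.1, hc.comp .fst, by simp⟩

theorem ClosedIn.and (hK : ClosedIn X K) (hK' : ClosedIn X K') :
    ClosedIn X fun h n => K h n ∧ K' h n := by
  obtain ⟨c, hc, h⟩ := hK
  obtain ⟨c', hc', h'⟩ := hK'
  refine ⟨fun p => c p && c' p, Primrec₂.comp_computableIn Primrec.and hc hc', fun f n => ?_⟩
  simp [h, h', forall_and]

theorem ClosedIn.ite (hK : ClosedIn X K) (hK' : ClosedIn X K') :
    ClosedIn X fun h n => if n.unpair.2 = 0 then K h n.unpair.1 else K' h n.unpair.1 := by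
  obtain ⟨c, hc, h⟩ := hK
  obtain ⟨c', hc', h'⟩ := hK'
  have hu : ComputableIn {(X : ℕ →. ℕ)} fun p : ℕ × List ℕ => (p.1.unpair.1, p.2) :=
    (Primrec.pair (Primrec.fst.comp (Primrec.unpair.comp Primrec.fst)) Primrec.snd).computableIn
  refine ⟨fun p => bif decide (p.1.unpair.2 = 0) then c (p.1.unpair.1, p.2)
    else c' (p.1.unpair.1, p.2), ComputableIn.cond ?_ (hc.comp hu) (hc'.comp hu), fun f n => ?_⟩
  · exact (PrimrecPred.decide (Primrec.eq.comp
      (Primrec.snd.comp (Primrec.unpair.comp Primrec.fst)) (Primrec.const 0))).computableIn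
  · by_cases h0 : n.unpair.2 = 0 <;> simp [h0, h, h']

/-- The length of the initial segment codes both the value of the quantified variable and the length
at which to test; the latter never exceeds the available length. -/
theorem ClosedIn.all (hK : ClosedIn X K) : ClosedIn X fun h n => ∀ i, K h (Nat.pair n i) := by
  obtain ⟨c, hc, h⟩ := hK
  refine ⟨fun p => c (Nat.pair p.1 p.2.length.unpair.1, p.2.take p.2.length.unpair.2),
    hc.comp (Primrec.computableIn ?_), fun f n => ?_⟩
  · have hl : Primrec fun p : ℕ × List ℕ => p.2.length.unpair :=
      Primrec.unpair.comp (Primrec.list_length.comp Primrec.snd)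
    exact Primrec.pair (Primrec₂.natPair.comp Primrec.fst (Primrec.fst.comp hl))
      (Primrec.list_take.comp (Primrec.snd.comp hl) Primrec.snd)
  · simp only [h, length_initSeg]
    constructor
    · intro H m
      rw [take_initSeg f (Nat.unpair_right_le m)]
      exact H _ _
    · intro H i m
      have := H (Nat.pair i m)
      rwa [take_initSeg f (Nat.unpair_right_le _), Nat.unpair_pair] at this

/-- Allows one function to carry several witnesses. A test is postponed until the segment contains
all values it consults; as lengths are pairs, each test recurs at arbitrarily large lengths. -/
theorem ClosedIn.reindex (hK : ClosedIn X K) {F φ N : ℕ → ℕ → ℕ} (hF : Primrec₂ F)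
    (hφ : Primrec₂ φ) (hN : Primrec₂ N) :
    ClosedIn X fun h n => K (fun t => F (h t) (h (φ n t))) (N n (h 0)) := by
  obtain ⟨c, hc, h⟩ := hK
  let j : ℕ × List ℕ → ℕ := fun p => p.2.length.unpair.1
  let a : ℕ × List ℕ → ℕ × List ℕ := fun p => (N p.1 (p.2.getD 0 0),
    (List.range (j p)).map fun t => F (p.2.getD t 0) (p.2.getD (φ p.1 t) 0))
  let good : ℕ × List ℕ → Prop := fun p => 0 < p.2.length ∧
    ∀ x ∈ (List.range (j p)).map (fun t => φ p.1 t), x < p.2.length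
  have hlen : Primrec fun p : ℕ × List ℕ => p.2.length := Primrec.list_length.comp Primrec.snd
  have hj : Primrec j := Primrec.fst.comp (Primrec.unpair.comp hlen)
  have hmap : Primrec fun p : ℕ × List ℕ => (List.range (j p)).map fun t => φ p.1 t :=
    Primrec.list_map (Primrec.list_range.comp hj)
      (hφ.comp₂ (Primrec.fst.comp Primrec.fst).to₂ Primrec.snd.to₂)
  have ha : Primrec a := by
    refine Primrec.pair (hN.comp Primrec.fst ((Primrec.list_getD 0).comp Primrec.snd
      (Primrec.const 0))) (Primrec.list_map (Primrec.list_range.comp hj) ?_)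
    refine hF.comp₂ ((Primrec.list_getD 0).comp₂ (Primrec.snd.comp Primrec.fst).to₂
      Primrec.snd.to₂) ((Primrec.list_getD 0).comp₂ (Primrec.snd.comp Primrec.fst).to₂ ?_)
    exact hφ.comp₂ (Primrec.fst.comp Primrec.fst).to₂ Primrec.snd.to₂
  have hgood : PrimrecPred good := by
    refine PrimrecPred.and (Primrec.nat_lt.comp (Primrec.const 0) hlen) ?_
    exact (PrimrecRel.forall_mem_list Primrec.nat_lt).comp hmap hlen
  classical
  refine ⟨fun p => bif decide (good p) then c (a p) else true,
    ComputableIn.cond (PrimrecPred.decide hgood).computableIn (hc.comp ha.computableIn)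
      (ComputableIn.const true), fun f n => ?_⟩
  have key : ∀ m, good (n, initSeg f m) → a (n, initSeg f m) =
      (N n (f 0), initSeg (fun t => F (f t) (f (φ n t))) m.unpair.1) := by
    rintro m ⟨h0, hm⟩
    simp only [length_initSeg, j] at h0 hm
    simp only [a, j, length_initSeg, getD_initSeg f h0, Prod.mk.injEq, true_and]
    refine List.map_congr_left fun t ht => ?_
    have ht' : t < m := (List.mem_range.1 ht).trans_le (Nat.unpair_left_le m)
    rw [getD_initSeg f ht', getD_initSeg f (hm _ (List.mem_map_of_mem ht))]
  beta_reduce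
  rw [h]
  constructor
  · intro H m
    by_cases hg : good (n, initSeg f m)
    · simp [hg, key m hg, H]
    · simp [hg]
  · intro H m
    obtain ⟨b, hb⟩ : ∃ b, ∀ x ∈ (List.range m).map (fun t => φ n t), x < b := by
      refine ⟨((List.range m).map (fun t => φ n t)).sum + 1, fun x hx => ?_⟩
      exact Nat.lt_succ_of_le (List.le_sum_of_mem hx)
    have hbm : b + 1 ≤ Nat.pair m (b + 1) := Nat.right_le_pair m (b + 1)
    have hg : good (n, initSeg f (Nat.pair m (b + 1))) := by
      refine ⟨by rw [length_initSeg]; omega, ?_⟩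
      simp only [j, length_initSeg, Nat.unpair_pair]
      intro x hx
      have := hb x hx
      omega
    -- At this length the test for `m` is requested and every position it needs is available.
    have := H (Nat.pair m (b + 1))
    simpa [hg, key _ hg] using this

/-- Segments too short to contain the value at `s n` pass; the first longer one decides. -/
theorem ClosedIn.app {s t : ℕ → ℕ} (hs : ComputableIn {(X : ℕ →. ℕ)} s)
    (ht : ComputableIn {(X : ℕ →. ℕ)} t) {R : ℕ → ℕ → Bool} (hR : Primrec₂ R) :
    ClosedIn X fun h n => R (h (s n)) (t n) = true := by
  refine ⟨fun p => bif decide (s p.1 < p.2.length) then R (p.2.getD (s p.1) 0) (t p.1) else true,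
    ComputableIn.cond ?_ ?_ (ComputableIn.const true), fun f n => ?_⟩
  · exact Primrec₂.comp_computableIn (f := fun a b : ℕ => decide (a < b))
      (PrimrecRel.decide Primrec.nat_lt) (hs.comp .fst)
      (Primrec.list_length.comp Primrec.snd).computableIn
  · exact Primrec₂.comp_computableIn hR (Primrec₂.comp_computableIn
      (f := fun (l : List ℕ) (n : ℕ) => l.getD n 0) (Primrec.list_getD 0) (Primrec.snd.computableIn) (hs.comp .fst)) (ht.comp .fst)
  · simp only [length_initSeg]
    constructor
    · intro H m
      by_cases hm : s n < m
      · simp only [hm, decide_true, cond_true, getD_initSeg f hm, H]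
      · simp [hm]
    · intro H
      have := H (s n + 1)
      rwa [getD_initSeg f (Nat.lt_succ_self (s n)), decide_eq_true (Nat.lt_succ_self (s n)),
        cond_true] at this

end Closed

/-- Relations of the form "some expansion of `f` satisfies a closed relation". -/
def IsSigmaClosedIn (X : ℕ → ℕ) (P : (ℕ → ℕ) → ℕ → Prop) : Prop :=
  ∃ K, ClosedIn X K ∧ ∀ f n, P f n ↔ ∃ g : ℕ → ℕ, K (fun i => Nat.pair (f i) (g i)) n

/-- Skolemization: carrying `P` and its negation together makes negation trivial. A universal number
quantifier merges countably many witnesses into one by pairing, while an existential choice is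
stored in the value of the witness at 0. -/
theorem ArithmeticalIn.isSigmaClosedIn {X : ℕ → ℕ} {P : (ℕ → ℕ) → ℕ → Prop}
    (hP : ArithmeticalIn X P) :
    IsSigmaClosedIn X P ∧ IsSigmaClosedIn X fun f n => ¬ P f n := by
  have hu1 : Primrec fun x : ℕ => x.unpair.1 := Primrec.fst.comp Primrec.unpair
  have hu2 : Primrec fun x : ℕ => x.unpair.2 := Primrec.snd.comp Primrec.unpair
  have hφ : Primrec₂ fun _ _ : ℕ => 0 := Primrec₂.const 0
  have hleft : Primrec₂ fun x _ : ℕ => Nat.pair x.unpair.1 x.unpair.2.unpair.1 :=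
    (Primrec₂.natPair.comp hu1 (hu1.comp hu2)).comp₂ Primrec₂.left
  have hright : Primrec₂ fun x _ : ℕ => Nat.pair x.unpair.1 x.unpair.2.unpair.2 :=
    (Primrec₂.natPair.comp hu1 (hu2.comp hu2)).comp₂ Primrec₂.left
  have hN : Primrec₂ fun n y : ℕ => Nat.pair n y.unpair.2.unpair.1 :=
    Primrec₂.natPair.comp₂ Primrec₂.left ((hu1.comp hu2).comp₂ Primrec₂.right)
  have heq : Primrec₂ fun a b : ℕ => decide (a = b) := PrimrecRel.decide Primrec.eq
  have hne : Primrec₂ fun a b : ℕ => !decide (a = b) := Primrec.not.comp₂ heq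
  induction hP with
  | eq hs ht =>
    exact ⟨⟨_, ClosedIn.const (Primrec₂.comp_computableIn heq hs ht), by simp⟩,
      ⟨_, ClosedIn.const (Primrec₂.comp_computableIn hne hs ht), by simp⟩⟩
  | app hs ht =>
    exact ⟨⟨_, ClosedIn.app hs ht (R := fun a b => decide (a.unpair.1 = b))
        (heq.comp₂ (hu1.comp₂ Primrec₂.left) Primrec₂.right), by simp⟩,
      ⟨_, ClosedIn.app hs ht (R := fun a b => !decide (a.unpair.1 = b))
        (hne.comp₂ (hu1.comp₂ Primrec₂.left) Primrec₂.right), by simp⟩⟩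
  | not _ ih => exact ⟨ih.2, by simpa only [not_not] using ih.1⟩
  | @and P Q _ _ ihP ihQ =>
    obtain ⟨⟨K, hK, h⟩, ⟨K', hK', h'⟩⟩ := ihP
    obtain ⟨⟨L, hL, l⟩, ⟨L', hL', l'⟩⟩ := ihQ
    refine ⟨⟨_, (hK.reindex hleft hφ Primrec₂.left).and (hL.reindex hright hφ Primrec₂.left),
      fun f n => ?_⟩, ⟨_, (hK'.ite hL').reindex hright hφ hN, fun f n => ?_⟩⟩
    · simp only [h, l, Nat.unpair_pair]
      constructor
      · rintro ⟨⟨g, hg⟩, ⟨g', hg'⟩⟩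
        exact ⟨fun i => Nat.pair (g i) (g' i), by simpa using ⟨hg, hg'⟩⟩
      · rintro ⟨g, hg, hg'⟩
        exact ⟨⟨_, hg⟩, ⟨_, hg'⟩⟩
    · beta_reduce at h' l' ⊢
      rw [not_and_or, h', l']
      simp only [Nat.unpair_pair]
      constructor
      · rintro (⟨g, hg⟩ | ⟨g, hg⟩)
        · exact ⟨fun i => Nat.pair 0 (g i), by simpa using hg⟩
        · exact ⟨fun i => Nat.pair 1 (g i), by simpa using hg⟩
      · rintro ⟨g, hg⟩
        split_ifs at hg with h0
        · exact Or.inl ⟨_, hg⟩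
        · exact Or.inr ⟨_, hg⟩
  | @all P _ ih =>
    obtain ⟨⟨K, hK, h⟩, ⟨K', hK', h'⟩⟩ := ih
    -- For the instance `i`, keep the value of `f` at `t` and take the witness from position
    -- `Nat.pair i t`.
    have hF : Primrec₂ fun x y : ℕ => Nat.pair x.unpair.1 y.unpair.2 :=
      Primrec₂.natPair.comp₂ (hu1.comp₂ Primrec₂.left) (hu2.comp₂ Primrec₂.right)
    have hψ : Primrec₂ fun n t : ℕ => Nat.pair n.unpair.2 t :=
      Primrec₂.natPair.comp₂ (hu2.comp₂ Primrec₂.left) Primrec₂.right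
    refine ⟨⟨_, (hK.reindex hF hψ Primrec₂.left).all, fun f n => ?_⟩,
      ⟨_, hK'.reindex hright hφ hN, fun f n => ?_⟩⟩
    · simp only [h, Nat.unpair_pair]
      constructor
      · intro H
        choose g hg using H
        exact ⟨fun i => g i.unpair.1 i.unpair.2, by simpa using hg⟩
      · rintro ⟨g, hg⟩ m
        exact ⟨_, hg m⟩
    · beta_reduce at h'
      simp only [not_forall, h', Nat.unpair_pair]
      constructor
      · rintro ⟨m, g, hg⟩
        exact ⟨fun i => Nat.pair m (g i), by simpa using hg⟩
      · rintro ⟨g, hg⟩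
        exact ⟨_, _, hg⟩

/-- Every `Π¹₁` set is given by the well-foundedness of a uniformly decidable family of trees. -/
theorem IsPi11In.exists_test {X : ℕ → ℕ} {S : Set ℕ} (hS : IsPi11In X S) :
    ∃ c : ℕ × List ℕ → Bool, ComputableIn {(X : ℕ →. ℕ)} c ∧
      ∀ n, n ∈ S ↔ ¬ ∃ h : ℕ → ℕ, ∀ m, c (n, initSeg h m) = true := by
  obtain ⟨P, hP, hPS⟩ := hS
  obtain ⟨K, ⟨c, hc, hcK⟩, hK⟩ := hP.isSigmaClosedIn.2
  refine ⟨c, hc, fun n => ?_⟩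
  rw [hPS, not_exists]
  simp only [← hcK]
  constructor
  · intro H h hh
    refine (hK (fun i => (h i).unpair.1) n).2 ⟨fun i => (h i).unpair.2, ?_⟩ (H _)
    simpa using hh
  · intro H f
    by_contra hf
    obtain ⟨g, hg⟩ := (hK f n).1 hf
    exact H _ hg

/-! ### From tests to sets of live nodes -/

/-- The nodes (last entry first) that pass the test; a node of length `m` is tested at its initial
segment of length `m.unpair.1`, so every test is repeated infinitely often along a path. -/
def liveNodes (c : ℕ × List ℕ → Bool) (n : ℕ) (l : List ℕ) : Bool :=
  c (n, l.reverse.take l.length.unpair.1)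

theorem liveNodes_of_path {c : ℕ × List ℕ → Bool} {n : ℕ} {h : ℕ → ℕ}
    (hh : ∀ m, c (n, initSeg h m) = true) (m : ℕ) :
    liveNodes c n (initSeg h m).reverse = true := by
  rw [liveNodes, List.reverse_reverse, List.length_reverse, length_initSeg,
    take_initSeg h (Nat.unpair_left_le m)]
  exact hh _

theorem initSeg_succ (h : ℕ → ℕ) (m : ℕ) : initSeg h (m + 1) = initSeg h m ++ [h m] := by
  rw [initSeg, List.range_succ, List.map_append]; rfl

/-- A path may start at any node, and live nodes need not be closed under initial segments. Tests
skipped below the starting node are recovered because each test recurs at longer nodes. -/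
theorem exists_path_of_hasPath {c : ℕ × List ℕ → Bool} {n : ℕ} (hp : HasPath (liveNodes c n)) :
    ∃ h : ℕ → ℕ, ∀ m, c (n, initSeg h m) = true := by
  obtain ⟨σ, hσ⟩ := hp
  choose hl x hx using hσ
  set L := (σ 0).length with hL
  let h : ℕ → ℕ := fun i => if i < L then (σ 0).reverse.getD i 0 else x (i - L)
  have hseg : ∀ i, (σ i).reverse = initSeg h (L + i) := by
    intro i
    induction i with
    | zero =>
      refine List.ext_getElem (by simp [hL]) fun j h1 h2 => ?_
      have hj : j < L := by simpa [hL] using h1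
      simp [initSeg, h, hj, hL ▸ hj]
    | succ i ih =>
      rw [hx, List.reverse_cons, ih, ← Nat.add_assoc, initSeg_succ]
      simp [h]
  refine ⟨h, fun m => ?_⟩
  -- Length `Nat.pair m L` is at least `L`, so the path has a node of this length, and that node is
  -- tested at its initial segment of length `m`.
  obtain ⟨d, hd⟩ := Nat.exists_eq_add_of_le (Nat.right_le_pair m L)
  have h1 := hl d
  have hlen : (σ d).length = L + d := by rw [← List.length_reverse, hseg, length_initSeg]
  rwa [liveNodes, hlen, hseg, ← hd, Nat.unpair_pair, take_initSeg h (Nat.left_le_pair m L)] at h1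

/-! ## Codes for vectors -/

section VecCode

open Encodable

/-- A code for a vector: a denominator (minus one), and lists of basis elements that occur
positively and negatively. -/
abbrev VecCode (B : Type) : Type := ℕ × List B × List B

/-- The number of occurrences of an element in a list. -/
def occ {B : Type} [DecidableEq B] (l : List B) (b : B) : ℕ := (l.filter fun a => a = b).length

/-- The sum of the basis vectors in a list. -/
noncomputable def basisSum {B : Type} (l : List B) : B →₀ ℚ :=
  (l.map fun b => Finsupp.single b 1).sum

/-- The vector with a given code. -/
noncomputable def VecCode.value {B : Type} (c : VecCode B) : B →₀ ℚ :=
  ((c.1 : ℚ) + 1)⁻¹ • (basisSum c.2.1 - basisSum c.2.2)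

theorem basisSum_append {B : Type} (l l' : List B) :
    basisSum (l ++ l') = basisSum l + basisSum l' := by
  simp [basisSum]

theorem basisSum_apply {B : Type} [DecidableEq B] (l : List B) (b : B) :
    basisSum l b = occ l b := by
  induction l with
  | nil => simp [basisSum, occ]
  | cons a l ih =>
    have h1 : basisSum (a :: l) = Finsupp.single a 1 + basisSum l := by simp [basisSum]
    rw [h1, Finsupp.add_apply, ih, Finsupp.single_apply, occ, occ, List.filter_cons]
    by_cases h : a = b <;> simp [h, add_comm]

theorem occ_eq_zero {B : Type} [DecidableEq B] {l : List B} {b : B} (h : b ∉ l) :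
    occ l b = 0 := by
  rw [occ, List.length_eq_zero_iff, List.filter_eq_nil_iff]
  intro a ha
  simpa using fun hab : a = b => h (hab ▸ ha)

theorem push_basisSum {B B' : Type} (s : B → Option B') (l : List B) :
    push s (basisSum l) = basisSum (l.filterMap s) := by
  induction l with
  | nil => simp [basisSum]
  | cons a l ih =>
    have h1 : basisSum (a :: l) = Finsupp.single a 1 + basisSum l := by simp [basisSum]
    rw [h1, map_add, ih, push_single, List.filterMap_cons]
    cases s a <;> simp [basisSum]

theorem push_value {B B' : Type} (s : B → Option B') (c : VecCode B) :
    push s c.value = VecCode.value (c.1, c.2.1.filterMap s, c.2.2.filterMap s) := by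
  simp [VecCode.value, push_basisSum]

theorem value_apply {B : Type} [DecidableEq B] (c : VecCode B) (b : B) :
    c.value b = ((c.1 : ℚ) + 1)⁻¹ * ((occ c.2.1 b : ℚ) - occ c.2.2 b) := by
  simp [VecCode.value, basisSum_apply]

/-- Repeat a list. -/
def repList {B : Type} (n : ℕ) (l : List B) : List B := (List.range n).flatMap fun _ => l

theorem basisSum_repList {B : Type} (n : ℕ) (l : List B) :
    basisSum (repList n l) = (n : ℚ) • basisSum l := by
  induction n with
  | zero => simp [repList, basisSum]
  | succ n ih =>
    rw [repList, List.range_succ, List.flatMap_append, basisSum_append, ← repList, ih]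
    simp [add_smul]

/-- Addition of codes. -/
def VecCode.add {B : Type} (c c' : VecCode B) : VecCode B :=
  (c.1 * (c'.1 + 1) + c'.1, repList (c'.1 + 1) c.2.1 ++ repList (c.1 + 1) c'.2.1,
    repList (c'.1 + 1) c.2.2 ++ repList (c.1 + 1) c'.2.2)

theorem value_add {B : Type} (c c' : VecCode B) : (c.add c').value = c.value + c'.value := by
  have h1 : (c.1 : ℚ) + 1 ≠ 0 := by positivity
  have h2 : (c'.1 : ℚ) + 1 ≠ 0 := by positivity
  have h3 : (c.1 : ℚ) * (c'.1 + 1) + c'.1 + 1 = (c.1 + 1) * (c'.1 + 1) := by ring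
  ext b
  simp only [VecCode.value, VecCode.add, basisSum_append, basisSum_repList, Finsupp.smul_apply,
    Finsupp.sub_apply, Finsupp.add_apply, smul_eq_mul]
  push_cast
  rw [h3]
  field_simp
  ring

/-- Equality of the coded vectors, as a relation between codes. -/
def VecCode.Equiv {B : Type} [DecidableEq B] (c c' : VecCode B) : Prop :=
  ∀ b ∈ (c.2.1 ++ c.2.2) ++ (c'.2.1 ++ c'.2.2),
    (c'.1 + 1) * occ c.2.1 b + (c.1 + 1) * occ c'.2.2 b =
      (c'.1 + 1) * occ c.2.2 b + (c.1 + 1) * occ c'.2.1 b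

theorem equiv_iff_value_eq {B : Type} [DecidableEq B] {c c' : VecCode B} :
    c.Equiv c' ↔ c.value = c'.value := by
  have h1 : (c.1 : ℚ) + 1 ≠ 0 := by positivity
  have h2 : (c'.1 : ℚ) + 1 ≠ 0 := by positivity
  have key : ∀ b, (c'.1 + 1) * occ c.2.1 b + (c.1 + 1) * occ c'.2.2 b =
      (c'.1 + 1) * occ c.2.2 b + (c.1 + 1) * occ c'.2.1 b ↔ c.value b = c'.value b := fun b => by
    rw [value_apply, value_apply, inv_mul_eq_div, inv_mul_eq_div, div_eq_div_iff h1 h2]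
    constructor
    · intro h
      have h3 : ((c'.1 : ℚ) + 1) * occ c.2.1 b + (c.1 + 1) * occ c'.2.2 b =
        (c'.1 + 1) * occ c.2.2 b + (c.1 + 1) * occ c'.2.1 b := by exact_mod_cast h
      linarith
    · intro h
      have h3 : ((c'.1 : ℚ) + 1) * occ c.2.1 b + (c.1 + 1) * occ c'.2.2 b =
        (c'.1 + 1) * occ c.2.2 b + (c.1 + 1) * occ c'.2.1 b := by linarith
      exact_mod_cast h3
  constructor
  · intro h
    ext b
    by_cases hb : b ∈ (c.2.1 ++ c.2.2) ++ (c'.2.1 ++ c'.2.2)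
    · exact (key b).1 (h b hb)
    · simp only [List.mem_append, not_or] at hb
      simp [value_apply, occ_eq_zero hb.1.1, occ_eq_zero hb.1.2, occ_eq_zero hb.2.1,
        occ_eq_zero hb.2.2]
  · intro h b _
    rw [key, h]

theorem exists_basisSum_sub {B : Type} (z : B →₀ ℤ) : ∃ u w : List B,
    z.mapRange ((↑) : ℤ → ℚ) Int.cast_zero = basisSum u - basisSum w := by
  induction z using Finsupp.induction_linear with
  | zero => exact ⟨[], [], by ext; simp⟩
  | add f g hf hg =>
    obtain ⟨u, w, h⟩ := hf
    obtain ⟨u', w', h'⟩ := hg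
    refine ⟨u ++ u', w ++ w', ?_⟩
    rw [basisSum_append, basisSum_append, add_sub_add_comm, ← h, ← h']
    ext; simp
  | single b n =>
    have hs : basisSum [b] = Finsupp.single b 1 := by simp [basisSum]
    obtain ⟨m, rfl | rfl⟩ := n.eq_nat_or_neg
    · exact ⟨repList m [b], [], by rw [basisSum_repList, hs]; simp [basisSum]⟩
    · exact ⟨[], repList m [b], by
        rw [basisSum_repList, hs, Finsupp.mapRange_single]; simp [basisSum]⟩

theorem exists_value_eq {B : Type} (v : B →₀ ℚ) : ∃ c : VecCode B, c.value = v := by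
  obtain ⟨N, hN, z, hz⟩ := exists_nsmul_integer v
  obtain ⟨u, w, h⟩ := exists_basisSum_sub z
  obtain ⟨d, rfl⟩ := Nat.exists_eq_succ_of_ne_zero hN
  refine ⟨(d, u, w), ?_⟩
  have hd : (d : ℚ) + 1 ≠ 0 := by positivity
  rw [VecCode.value, ← h, ← hz]
  ext b
  simp
  field_simp

/-- Integrality of a difference quotient of natural numbers at a prime. -/
theorem integralAt_iff_exists {p : ℕ} (d x y : ℕ) :
    IntegralAt p (((d : ℚ) + 1)⁻¹ * ((x : ℚ) - y)) ↔
      ∃ m ∈ List.range (d + 2), m % p ≠ 0 ∧ x * m % (d + 1) = y * m % (d + 1) := by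
  have hd : (d : ℚ) + 1 ≠ 0 := by positivity
  set q : ℚ := ((d : ℚ) + 1)⁻¹ * ((x : ℚ) - y) with hq
  have hq' : q = (((x : ℤ) - y : ℤ) : ℚ) / ((d + 1 : ℕ) : ℚ) := by
    rw [hq]; push_cast; field_simp
  constructor
  · intro h
    have hden : q.den ∣ d + 1 := by
      have := Rat.den_dvd ((x : ℤ) - y) ((d + 1 : ℕ) : ℤ)
      rw [Rat.divInt_eq_div] at this
      rw [hq']
      exact_mod_cast this
    -- The reduced denominator divides `d + 1`, so it lies in the range searched.
    refine ⟨q.den, ?_, ?_, ?_⟩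
    · rw [List.mem_range]
      have := Nat.le_of_dvd (Nat.succ_pos d) hden
      omega
    · rwa [Ne, ← Nat.dvd_iff_mod_eq_zero]
    · have h1 : ((x : ℚ) - y) * q.den = q.num * (d + 1) := by
        have h2 : q * q.den = q.num := Rat.mul_den_eq_num q
        rw [← h2, hq]; field_simp
      have h2 : ((x : ℤ) - y) * q.den = q.num * (d + 1) := by exact_mod_cast h1
      have h3 : (x * q.den : ℕ) ≡ (y * q.den : ℕ) [MOD (d + 1)] := by
        refine ((Nat.modEq_iff_dvd).2 ⟨q.num, ?_⟩).symm
        push_cast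
        linear_combination h2
      exact h3
  · rintro ⟨m, -, hmp, hm⟩
    have h3 : (y * m : ℕ) ≡ (x * m : ℕ) [MOD (d + 1)] := hm.symm
    obtain ⟨t, ht⟩ := (Nat.modEq_iff_dvd).1 h3
    have hm0 : (m : ℚ) ≠ 0 := by
      have : m ≠ 0 := by rintro rfl; simp at hmp
      exact_mod_cast this
    have h4 : ((x : ℚ) - y) * m = (d + 1) * t := by
      have : (x : ℚ) * m - y * m = (d + 1) * t := by exact_mod_cast ht
      linear_combination this
    have h5 : q = (t : ℚ) / m := by
      rw [hq]; field_simp; linear_combination h4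
    rw [h5]
    exact IntegralAt.div t fun hd => hmp ((Nat.dvd_iff_mod_eq_zero).1 hd)

/-- The conditions (a prime, a label and a basis element) that have to be checked in order to
decide whether a coded vector lies in the group. -/
def memChecks {ι B : Type} [Encodable ι] (s : ι → B → Option B) (c : VecCode B) :
    List (ℕ × ι × B) :=
  (List.range (c.1 + 2)).flatMap fun p => ((List.range p).filterMap (decode (α := ι))).flatMap
    fun i => ((c.2.1 ++ c.2.2).filterMap (s i)).map fun b => (p, i, b)

/-- Finitely many conditions suffice: primes beyond the denominator impose nothing, a label is
smaller than each of its primes, and basis elements not hit by the substitution have coefficient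
zero. -/
theorem value_mem_substGroup {ι B : Type} [Encodable ι] [DecidableEq B] (s : ι → B → Option B)
    (c : VecCode B) : c.value ∈ substGroup s ↔ ∀ t ∈ memChecks s c,
      t.1 ∈ labelPrimes (encode t.2.1) → ∃ m ∈ List.range (c.1 + 2), m % t.1 ≠ 0 ∧
        occ (c.2.1.filterMap (s t.2.1)) t.2.2 * m % (c.1 + 1) =
          occ (c.2.2.filterMap (s t.2.1)) t.2.2 * m % (c.1 + 1) := by
  simp only [mem_substGroup, push_value, value_apply, integralAt_iff_exists]
  constructor
  · intro H t _ ht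
    exact H _ _ ht _
  · intro H i p hp b
    by_cases hb : b ∈ (c.2.1 ++ c.2.2).filterMap (s i)
    · by_cases hpd : p ≤ c.1 + 1
      · refine H (p, i, b) ?_ hp
        rw [memChecks, List.mem_flatMap]
        refine ⟨p, List.mem_range.2 (by omega), ?_⟩
        rw [List.mem_flatMap]
        refine ⟨i, ?_, List.mem_map_of_mem hb⟩
        rw [List.mem_filterMap]
        refine ⟨encode i, List.mem_range.2 ?_, encodek i⟩
        have h1 := hp.2
        have h2 : encode i < 2 ^ encode i := Nat.lt_two_pow_self
        have h3 := Nat.mod_le p (2 ^ (encode i + 3))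
        rw [h1, pow_add] at h3
        omega
      -- For a prime exceeding the denominator, the denominator itself is a multiplier prime to it.
      · refine ⟨c.1 + 1, List.mem_range.2 (by omega), ?_, by simp⟩
        rw [Nat.mod_eq_of_lt (by omega)]
        omega
    · refine ⟨1, List.mem_range.2 (by omega), ?_, ?_⟩
      · rw [Nat.mod_eq_of_lt hp.1.one_lt]; exact one_ne_zero
      · rw [List.filterMap_append, List.mem_append, not_or] at hb
        rw [occ_eq_zero hb.1, occ_eq_zero hb.2]

theorem value_mem_substGroup_congr {ι B : Type} [Encodable ι]
    {s s' : ι → B → Option B} {c : VecCode B} (h : ∀ i, ∀ b ∈ c.2.1 ++ c.2.2, s i b = s' i b) :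
    c.value ∈ substGroup s ↔ c.value ∈ substGroup s' := by
  have h1 : ∀ i, c.2.1.filterMap (s i) = c.2.1.filterMap (s' i) := fun i =>
    List.filterMap_congr fun b hb => h i b (List.mem_append_left _ hb)
  have h2 : ∀ i, c.2.2.filterMap (s i) = c.2.2.filterMap (s' i) := fun i =>
    List.filterMap_congr fun b hb => h i b (List.mem_append_right _ hb)
  simp only [mem_substGroup, push_value, h1, h2]

end VecCode

/-! ## Primitive recursiveness of the operations on codes -/

section PrimrecCodes

open Encodable

theorem primrec_natPow : Primrec₂ ((· ^ ·) : ℕ → ℕ → ℕ) := Primrec₂.unpaired'.1 Nat.Primrec.pow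

theorem primrecPred_natPrime : PrimrecPred Nat.Prime := by
  have h1 : PrimrecPred fun p : ℕ => 2 ≤ p := Primrec.nat_le.comp (Primrec.const 2) Primrec.id
  have h2 : PrimrecRel fun m p : ℕ => ¬ (2 ≤ m ∧ p % m = 0) :=
    PrimrecPred.not (PrimrecPred.and (Primrec.nat_le.comp (Primrec.const 2) Primrec.fst)
      (Primrec.eq.comp (Primrec.nat_mod.comp Primrec.snd Primrec.fst) (Primrec.const 0)))
  have h3 : PrimrecPred fun p : ℕ => ∀ m < p, ¬ (2 ≤ m ∧ p % m = 0) :=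
    (PrimrecRel.forall_lt h2).comp Primrec.id Primrec.id
  refine PrimrecPred.of_eq (h1.and h3) fun p => ?_
  rw [Nat.prime_def_lt']
  refine and_congr_right fun _ => forall_congr' fun m => ?_
  rw [Nat.dvd_iff_mod_eq_zero]
  tauto

theorem primrecRel_mem_labelPrimes : PrimrecRel fun e p : ℕ => p ∈ labelPrimes e := by
  have hp : ∀ j, Primrec fun t : ℕ × ℕ => 2 ^ (t.1 + j) := fun j =>
    primrec_natPow.comp (Primrec.const 2) (Primrec.nat_add.comp Primrec.fst (Primrec.const j))
  exact PrimrecPred.and (primrecPred_natPrime.comp Primrec.snd)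
    (Primrec.eq.comp (Primrec.nat_mod.comp Primrec.snd (hp 3))
      (Primrec.nat_sub.comp (hp 2) (Primrec.const 1)))

variable {B : Type} [Primcodable B]

theorem primrec_occ [DecidableEq B] : Primrec₂ (occ : List B → B → ℕ) :=
  Primrec.list_length.comp₂ (PrimrecRel.listFilter (R := fun a b : B => a = b) Primrec.eq)

theorem primrec_repList : Primrec₂ (repList : ℕ → List B → List B) :=
  Primrec.list_flatMap (Primrec.list_range.comp Primrec.fst) (Primrec.snd.comp Primrec.fst).to₂

theorem primrec_add : Primrec₂ (VecCode.add : VecCode B → VecCode B → VecCode B) := by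
  have d : Primrec fun t : VecCode B × VecCode B => t.1.1 := Primrec.fst.comp Primrec.fst
  have d' : Primrec fun t : VecCode B × VecCode B => t.2.1 := Primrec.fst.comp Primrec.snd
  have u : Primrec fun t : VecCode B × VecCode B => t.1.2.1 :=
    Primrec.fst.comp (Primrec.snd.comp Primrec.fst)
  have u' : Primrec fun t : VecCode B × VecCode B => t.2.2.1 :=
    Primrec.fst.comp (Primrec.snd.comp Primrec.snd)
  have w : Primrec fun t : VecCode B × VecCode B => t.1.2.2 :=
    Primrec.snd.comp (Primrec.snd.comp Primrec.fst)
  have w' : Primrec fun t : VecCode B × VecCode B => t.2.2.2 :=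
    Primrec.snd.comp (Primrec.snd.comp Primrec.snd)
  have e := Primrec.succ.comp d
  have e' := Primrec.succ.comp d'
  exact Primrec.pair (Primrec.nat_add.comp (Primrec.nat_mul.comp d e') d')
    (Primrec.pair
      (Primrec.list_append.comp (primrec_repList.comp e' u) (primrec_repList.comp e u'))
      (Primrec.list_append.comp (primrec_repList.comp e' w) (primrec_repList.comp e w')))

theorem primrecRel_equiv [DecidableEq B] : PrimrecRel (VecCode.Equiv : VecCode B → VecCode B → Prop) := by
  have d : Primrec fun t : VecCode B × VecCode B => t.1.1 := Primrec.fst.comp Primrec.fst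
  have d' : Primrec fun t : VecCode B × VecCode B => t.2.1 := Primrec.fst.comp Primrec.snd
  have u : Primrec fun t : VecCode B × VecCode B => t.1.2.1 :=
    Primrec.fst.comp (Primrec.snd.comp Primrec.fst)
  have u' : Primrec fun t : VecCode B × VecCode B => t.2.2.1 :=
    Primrec.fst.comp (Primrec.snd.comp Primrec.snd)
  have w : Primrec fun t : VecCode B × VecCode B => t.1.2.2 :=
    Primrec.snd.comp (Primrec.snd.comp Primrec.fst)
  have w' : Primrec fun t : VecCode B × VecCode B => t.2.2.2 :=
    Primrec.snd.comp (Primrec.snd.comp Primrec.snd)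
  have e := Primrec.succ.comp d
  have e' := Primrec.succ.comp d'
  have side : ∀ {f g x y : VecCode B × VecCode B → ℕ} {m n : VecCode B × VecCode B → List B},
      Primrec f → Primrec g → Primrec m → Primrec n →
      Primrec fun t : B × VecCode B × VecCode B =>
        f t.2 * occ (m t.2) t.1 + g t.2 * occ (n t.2) t.1 := fun hf hg hm hn =>
    Primrec.nat_add.comp
      (Primrec.nat_mul.comp (hf.comp Primrec.snd)
        (primrec_occ.comp (hm.comp Primrec.snd) Primrec.fst))
      (Primrec.nat_mul.comp (hg.comp Primrec.snd)
        (primrec_occ.comp (hn.comp Primrec.snd) Primrec.fst))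
  have hR : PrimrecRel fun (b : B) (t : VecCode B × VecCode B) =>
      (t.2.1 + 1) * occ t.1.2.1 b + (t.1.1 + 1) * occ t.2.2.2 b =
        (t.2.1 + 1) * occ t.1.2.2 b + (t.1.1 + 1) * occ t.2.2.1 b :=
    Primrec.eq.comp (side (x := fun _ => 0) (y := fun _ => 0) e' e u w')
      (side (x := fun _ => 0) (y := fun _ => 0) e' e w u')
  exact hR.forall_mem_list.comp
    (Primrec.list_append.comp (Primrec.list_append.comp u w) (Primrec.list_append.comp u' w'))
    Primrec.id

/-- The substitutions of the tree group, with the live nodes given by a list of bits, are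
primitive recursive. -/
theorem primrec_treeSubst : Primrec fun t : List ℕ × TreeLabel × TreeBasis =>
    treeSubst (fun l => decide (t.1.getD (encode l) 0 = 1)) t.2.1 t.2.2 := by
  have inl' : Primrec fun t : ℕ × ℕ × List ℕ => (some (.inl t) : Option TreeBasis) :=
    Primrec.option_some.comp Primrec.sumInl
  have inr' : Primrec fun y : ℕ × ℕ => (some (.inr y) : Option TreeBasis) :=
    Primrec.option_some.comp Primrec.sumInr
  have lst : Primrec fun t : ℕ × ℕ × List ℕ => t.2.2 := Primrec.snd.comp Primrec.snd
  have len : Primrec fun t : ℕ × ℕ × List ℕ => t.2.2.length := Primrec.list_length.comp lst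
  have none' : ∀ {α : Type} [Primcodable α], Primrec fun _ : α => (none : Option TreeBasis) :=
    Primrec.const none
  -- levels
  have h1 : Primrec fun t : (List ℕ × ℕ) × TreeBasis =>
      treeSubst (fun l => decide (t.1.1.getD (encode l) 0 = 1)) (.inl t.1.2) t.2 := by
    refine (Primrec.sumCasesOn (f := fun t : (List ℕ × ℕ) × TreeBasis => t.2)
      (g := fun t s => if s.2.2.length = t.1.2 ∧ t.1.1.getD (encode s.2.2) 0 = 1 then none
        else some (.inl s))
      (h := fun t y => if y.2 = t.1.2 then none else some (.inr y)) Primrec.snd ?_ ?_).of_eq ?_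
    · refine Primrec.ite (PrimrecPred.and (Primrec.eq.comp (len.comp Primrec.snd)
        (Primrec.snd.comp (Primrec.fst.comp Primrec.fst))) (Primrec.eq.comp
          ((Primrec.list_getD 0).comp (Primrec.fst.comp (Primrec.fst.comp Primrec.fst))
          (Primrec.encode.comp (lst.comp Primrec.snd))) (Primrec.const 1))) none'
        (inl'.comp Primrec.snd)
    · exact Primrec.ite (Primrec.eq.comp (Primrec.snd.comp Primrec.snd)
        (Primrec.snd.comp (Primrec.fst.comp Primrec.fst))) none' (inr'.comp Primrec.snd)
    · rintro ⟨⟨bits, n⟩, t | y⟩ <;> simp [treeSubst]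
  -- edges
  have h2 : Primrec fun t : (List ℕ × ℕ) × TreeBasis =>
      treeSubst (fun l => decide (t.1.1.getD (encode l) 0 = 1)) (.inr (.inl t.1.2)) t.2 := by
    refine (Primrec.sumCasesOn (f := fun t : (List ℕ × ℕ) × TreeBasis => t.2)
      (g := fun t s => if s.2.2.length = t.1.2 + 1 then some (.inl (s.1, s.2.1, s.2.2.tail))
        else some (.inl s))
      (h := fun t y => some (.inr y)) Primrec.snd ?_ (inr'.comp Primrec.snd).to₂).of_eq ?_
    · refine Primrec.ite (Primrec.eq.comp (len.comp Primrec.snd)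
        (Primrec.succ.comp (Primrec.snd.comp (Primrec.fst.comp Primrec.fst))))
        (inl'.comp ?_) (inl'.comp Primrec.snd)
      exact Primrec.pair (Primrec.fst.comp Primrec.snd) (Primrec.pair
        (Primrec.fst.comp (Primrec.snd.comp Primrec.snd))
        (Primrec.list_tail.comp (lst.comp Primrec.snd)))
    · rintro ⟨⟨bits, n⟩, t | y⟩ <;> simp [treeSubst]
  -- lines
  have h3 : Primrec fun t : (List ℕ × ℕ × ℕ × List ℕ) × TreeBasis =>
      treeSubst (fun l => decide (t.1.1.getD (encode l) 0 = 1)) (.inr (.inr t.1.2)) t.2 := by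
    refine (Primrec.sumCasesOn (f := fun t : (List ℕ × ℕ × ℕ × List ℕ) × TreeBasis => t.2)
      (g := fun t s => if s = t.1.2 then some (.inr (t.1.2.1, t.1.2.2.2.length))
        else some (.inl s))
      (h := fun t y => some (.inr y)) Primrec.snd ?_ (inr'.comp Primrec.snd).to₂).of_eq ?_
    · have e : Primrec fun p : ((List ℕ × ℕ × ℕ × List ℕ) × TreeBasis) × ℕ × ℕ × List ℕ =>
          p.1.1.2 := Primrec.snd.comp (Primrec.fst.comp Primrec.fst)
      exact Primrec.ite (Primrec.eq.comp Primrec.snd e)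
        (inr'.comp (Primrec.pair (Primrec.fst.comp e) (len.comp e))) (inl'.comp Primrec.snd)
    · rintro ⟨⟨bits, n⟩, t | y⟩ <;> simp [treeSubst]
  have hb : Primrec fun t : List ℕ × TreeLabel × TreeBasis => t.2.2 :=
    Primrec.snd.comp Primrec.snd
  refine (Primrec.sumCasesOn (f := fun t : List ℕ × TreeLabel × TreeBasis => t.2.1)
    (g := fun t n => treeSubst (fun l => decide (t.1.getD (encode l) 0 = 1)) (.inl n) t.2.2)
    (h := fun t i => treeSubst (fun l => decide (t.1.getD (encode l) 0 = 1)) (.inr i) t.2.2)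
    (Primrec.fst.comp Primrec.snd) ?_ ?_).of_eq ?_
  · exact h1.comp (Primrec.pair (Primrec.pair (Primrec.fst.comp Primrec.fst) Primrec.snd)
      (hb.comp Primrec.fst))
  · refine (Primrec.sumCasesOn
      (f := fun p : (List ℕ × TreeLabel × TreeBasis) × (ℕ ⊕ ℕ × ℕ × List ℕ) => p.2)
      (g := fun p n => treeSubst (fun l => decide (p.1.1.getD (encode l) 0 = 1))
        (.inr (.inl n)) p.1.2.2)
      (h := fun p i => treeSubst (fun l => decide (p.1.1.getD (encode l) 0 = 1))
        (.inr (.inr i)) p.1.2.2) Primrec.snd ?_ ?_).of_eq ?_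
    · exact h2.comp (Primrec.pair (Primrec.pair (Primrec.fst.comp (Primrec.fst.comp Primrec.fst))
        Primrec.snd) (hb.comp (Primrec.fst.comp Primrec.fst)))
    · exact h3.comp (Primrec.pair (Primrec.pair (Primrec.fst.comp (Primrec.fst.comp Primrec.fst))
        Primrec.snd) (hb.comp (Primrec.fst.comp Primrec.fst)))
    · rintro ⟨t, n | s⟩ <;> rfl
  · rintro ⟨bits, i | i, b⟩ <;> rfl

/-- The nodes whose bit in the list is `1`. -/
def bitNodes (bits : List ℕ) (l : List ℕ) : Bool := decide (bits.getD (encode l) 0 = 1)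

theorem primrec_filterMap_treeSubst : Primrec fun t : List ℕ × TreeLabel × List TreeBasis =>
    t.2.2.filterMap (treeSubst (bitNodes t.1) t.2.1) :=
  Primrec.listFilterMap (Primrec.snd.comp Primrec.snd) (primrec_treeSubst.comp
    (Primrec.pair (Primrec.fst.comp Primrec.fst)
      (Primrec.pair (Primrec.fst.comp (Primrec.snd.comp Primrec.fst)) Primrec.snd)))

theorem primrec_memChecks : Primrec fun y : List ℕ × VecCode TreeBasis =>
    memChecks (treeSubst (bitNodes y.1)) y.2 := by
  have hd : Primrec fun y : List ℕ × VecCode TreeBasis => y.2.1 := Primrec.fst.comp Primrec.snd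
  have hu : Primrec fun y : List ℕ × VecCode TreeBasis => y.2.2.1 ++ y.2.2.2 :=
    Primrec.list_append.comp (Primrec.fst.comp (Primrec.snd.comp Primrec.snd))
      (Primrec.snd.comp (Primrec.snd.comp Primrec.snd))
  refine Primrec.list_flatMap (Primrec.list_range.comp
    (Primrec.nat_add.comp hd (Primrec.const 2))) ?_
  refine Primrec.list_flatMap (Primrec.listFilterMap (Primrec.list_range.comp Primrec.snd)
    (Primrec.decode.comp Primrec.snd).to₂) ?_
  refine Primrec.list_map (primrec_filterMap_treeSubst.comp
    (Primrec.pair (Primrec.fst.comp (Primrec.fst.comp Primrec.fst))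
      (Primrec.pair Primrec.snd (hu.comp (Primrec.fst.comp Primrec.fst))))) ?_
  exact Primrec.pair (Primrec.snd.comp (Primrec.fst.comp Primrec.fst))
    (Primrec.pair (Primrec.snd.comp Primrec.fst) Primrec.snd)

/-- Integrality at `p` of the coefficient of `b` in a coded vector. -/
def VecCode.IntegralCoeff (p : ℕ) (b : TreeBasis) (c : VecCode TreeBasis) : Prop :=
  ∃ m ∈ List.range (c.1 + 2), m % p ≠ 0 ∧ occ c.2.1 b * m % (c.1 + 1) = occ c.2.2 b * m % (c.1 + 1)

theorem primrecPred_integralCoeff : PrimrecPred fun t : (ℕ × TreeBasis) × VecCode TreeBasis =>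
    t.2.IntegralCoeff t.1.1 t.1.2 := by
  have hd : Primrec fun q : ℕ × (ℕ × TreeBasis) × VecCode TreeBasis => q.2.2.1 :=
    Primrec.fst.comp (Primrec.snd.comp Primrec.snd)
  have hocc : ∀ {f : VecCode TreeBasis → List TreeBasis}, Primrec f →
      Primrec fun q : ℕ × (ℕ × TreeBasis) × VecCode TreeBasis =>
        occ (f q.2.2) q.2.1.2 * q.1 % (q.2.2.1 + 1) := fun hf =>
    Primrec.nat_mod.comp (Primrec.nat_mul.comp (primrec_occ.comp
      (hf.comp (Primrec.snd.comp Primrec.snd))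
      (Primrec.snd.comp (Primrec.fst.comp Primrec.snd))) Primrec.fst) (Primrec.succ.comp hd)
  have hinner : PrimrecRel fun (m : ℕ) (t : (ℕ × TreeBasis) × VecCode TreeBasis) =>
      m % t.1.1 ≠ 0 ∧
        occ t.2.2.1 t.1.2 * m % (t.2.1 + 1) = occ t.2.2.2 t.1.2 * m % (t.2.1 + 1) :=
    PrimrecPred.and (PrimrecPred.not (Primrec.eq.comp (Primrec.nat_mod.comp Primrec.fst
      (Primrec.fst.comp (Primrec.fst.comp Primrec.snd))) (Primrec.const 0)))
      (Primrec.eq.comp (hocc (f := fun c => c.2.1) (Primrec.fst.comp Primrec.snd))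
        (hocc (f := fun c => c.2.2) (Primrec.snd.comp Primrec.snd)))
  exact hinner.exists_mem_list.comp (Primrec.list_range.comp
    (Primrec.nat_add.comp (Primrec.fst.comp Primrec.snd) (Primrec.const 2))) Primrec.id

/-- The condition to be checked for a prime, a label and a basis element. -/
def memCondition (t : ℕ × TreeLabel × TreeBasis) (y : List ℕ × VecCode TreeBasis) : Prop :=
  ¬ t.1 ∈ labelPrimes (encode t.2.1) ∨ VecCode.IntegralCoeff t.1 t.2.2
    (y.2.1, y.2.2.1.filterMap (treeSubst (bitNodes y.1) t.2.1),
      y.2.2.2.filterMap (treeSubst (bitNodes y.1) t.2.1))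

theorem primrecRel_memCondition : PrimrecRel memCondition := by
  have hi : Primrec fun z : (ℕ × TreeLabel × TreeBasis) × List ℕ × VecCode TreeBasis => z.1.2.1 :=
    Primrec.fst.comp (Primrec.snd.comp Primrec.fst)
  have hbit : Primrec fun z : (ℕ × TreeLabel × TreeBasis) × List ℕ × VecCode TreeBasis => z.2.1 :=
    Primrec.fst.comp Primrec.snd
  have hc : Primrec fun z : (ℕ × TreeLabel × TreeBasis) × List ℕ × VecCode TreeBasis => z.2.2 :=
    Primrec.snd.comp Primrec.snd
  have hf : ∀ {f : VecCode TreeBasis → List TreeBasis}, Primrec f →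
      Primrec fun z : (ℕ × TreeLabel × TreeBasis) × List ℕ × VecCode TreeBasis =>
        (f z.2.2).filterMap (treeSubst (bitNodes z.2.1) z.1.2.1) := fun hf =>
    primrec_filterMap_treeSubst.comp (Primrec.pair hbit (Primrec.pair hi (hf.comp hc)))
  refine PrimrecPred.or (PrimrecPred.not (primrecRel_mem_labelPrimes.comp
    (Primrec.encode.comp hi) (Primrec.fst.comp Primrec.fst)))
    (primrecPred_integralCoeff.comp (Primrec.pair (Primrec.pair (Primrec.fst.comp Primrec.fst)
      (Primrec.snd.comp (Primrec.snd.comp Primrec.fst))) (Primrec.pair (Primrec.fst.comp hc)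
        (Primrec.pair (hf (f := fun c => c.2.1) (Primrec.fst.comp Primrec.snd))
          (hf (f := fun c => c.2.2) (Primrec.snd.comp Primrec.snd))))))

theorem primrecRel_value_mem : PrimrecRel fun (bits : List ℕ) (c : VecCode TreeBasis) =>
    c.value ∈ treeGroup (bitNodes bits) :=
  (primrecRel_memCondition.forall_mem_list.comp primrec_memChecks Primrec.id).of_eq fun y => by
    refine Iff.trans ?_ (value_mem_substGroup _ _).symm
    simp only [memCondition, VecCode.IntegralCoeff, imp_iff_not_or, id]

end PrimrecCodes

/-! ## Numbering the elements of the group -/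

section Numbering

open Encodable

/-- The number of a vector code. -/
def vecCodeNum (c : VecCode TreeBasis) : ℕ := @encode _ Primcodable.toEncodable c

theorem primrec_vecCodeNum : Primrec vecCodeNum := Primrec.encode

/-- The vector code with a given number. -/
def vecCodeOf (a : ℕ) : VecCode TreeBasis :=
  (@decode (VecCode TreeBasis) Primcodable.toEncodable a).getD (0, [], [])

theorem vecCodeOf_vecCodeNum (c : VecCode TreeBasis) : vecCodeOf (vecCodeNum c) = c := by
  rw [vecCodeOf, vecCodeNum, encodek, Option.getD_some]

theorem primrec_vecCodeOf : Primrec vecCodeOf :=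
  Primrec.option_getD.comp Primrec.decode (Primrec.const _)

theorem exists_value_vecCodeOf (v : TreeBasis →₀ ℚ) : ∃ a, (vecCodeOf a).value = v := by
  obtain ⟨c, hc⟩ := exists_value_eq v
  exact ⟨vecCodeNum c, by rw [vecCodeOf_vecCodeNum]; exact hc⟩

open Classical in
/-- The least number of a vector. -/
noncomputable def leastCode (v : TreeBasis →₀ ℚ) : ℕ := Nat.find (exists_value_vecCodeOf v)

theorem value_leastCode (v : TreeBasis →₀ ℚ) : (vecCodeOf (leastCode v)).value = v := by
  classical
  exact Nat.find_spec (exists_value_vecCodeOf v)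

theorem leastCode_injective : Function.Injective leastCode := fun v w h => by
  rw [← value_leastCode v, h, value_leastCode]

open Classical in
/-- The least number of the vector with a given number. -/
noncomputable def normCode (r : ℕ) : ℕ :=
  (List.range (r + 1)).findIdx fun a => decide ((vecCodeOf a).Equiv (vecCodeOf r))

theorem primrec_normCode : Primrec normCode := by
  classical
  exact Primrec.list_findIdx (p := fun r a => decide ((vecCodeOf a).Equiv (vecCodeOf r)))
    (Primrec.list_range.comp Primrec.succ)
    (PrimrecRel.decide (R := fun r a => (vecCodeOf a).Equiv (vecCodeOf r))
      (primrecRel_equiv.comp (primrec_vecCodeOf.comp Primrec.snd)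
        (primrec_vecCodeOf.comp Primrec.fst)))

/-- The least number of a vector is at most any of its numbers, so the bounded search below `r`
finds it. -/
theorem normCode_eq (r : ℕ) : normCode r = leastCode (vecCodeOf r).value := by
  classical
  have hle : leastCode (vecCodeOf r).value ≤ r := Nat.find_min' _ rfl
  rw [normCode, List.findIdx_eq (by rw [List.length_range]; omega)]
  simp only [List.getElem_range, decide_eq_true_eq, decide_eq_false_iff_not, equiv_iff_value_eq]
  exact ⟨value_leastCode _, fun j hj => Nat.find_min _ hj⟩

/-- The number of the sum of two vectors. -/
noncomputable def addCode (a b : ℕ) : ℕ := normCode (vecCodeNum ((vecCodeOf a).add (vecCodeOf b)))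

theorem primrec_addCode : Primrec₂ addCode := by
  have h : Primrec fun t : ℕ × ℕ => (vecCodeOf t.1).add (vecCodeOf t.2) :=
    primrec_add.comp (primrec_vecCodeOf.comp Primrec.fst) (primrec_vecCodeOf.comp Primrec.snd)
  exact primrec_normCode.comp (primrec_vecCodeNum.comp h)

attribute [irreducible] normCode leastCode vecCodeOf vecCodeNum

theorem addCode_leastCode (v w : TreeBasis →₀ ℚ) :
    addCode (leastCode v) (leastCode w) = leastCode (v + w) := by
  rw [addCode, normCode_eq]
  refine congrArg leastCode ?_
  rw [vecCodeOf_vecCodeNum, value_add, value_leastCode, value_leastCode]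

/-- A bound for the numbers of the nodes that occur in a coded vector. -/
def nodeBound (c : VecCode TreeBasis) : ℕ :=
  ((c.2.1 ++ c.2.2).map fun b => Sum.elim (fun t => encode t.2.2) (fun _ => 0) b).sum + 1

theorem encode_lt_nodeBound {c : VecCode TreeBasis} {t : ℕ × ℕ × List ℕ}
    (h : (.inl t : TreeBasis) ∈ c.2.1 ++ c.2.2) : encode t.2.2 < nodeBound c :=
  Nat.lt_succ_of_le (List.le_sum_of_mem (List.mem_map.2 ⟨_, h, rfl⟩))

theorem primrec_nodeBound : Primrec nodeBound := by
  have hl : Primrec fun c : VecCode TreeBasis => c.2.1 ++ c.2.2 :=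
    Primrec.list_append.comp (Primrec.fst.comp Primrec.snd) (Primrec.snd.comp Primrec.snd)
  have he : Primrec fun b : TreeBasis => Sum.elim (fun t => encode t.2.2) (fun _ => 0) b := by
    refine (Primrec.sumCasesOn (f := fun b : TreeBasis => b) (g := fun _ t => encode t.2.2)
      (h := fun _ _ => 0) Primrec.id ?_ (Primrec₂.const 0)).of_eq ?_
    · exact Primrec.encode.comp (Primrec.snd.comp (Primrec.snd.comp Primrec.snd))
    · rintro (t | y) <;> rfl
  have hs : Primrec fun l : List ℕ => l.sum :=
    (Primrec.list_foldr (f := fun l : List ℕ => l) (g := fun _ => 0)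
      (h := fun _ p => p.1 + p.2) Primrec.id (Primrec.const 0)
      (Primrec.nat_add.comp₂ (Primrec.fst.comp Primrec.snd).to₂
        (Primrec.snd.comp Primrec.snd).to₂)).of_eq fun l => by rw [List.sum_eq_foldr]
  exact Primrec.succ.comp (hs.comp (Primrec.list_map hl (he.comp₂ Primrec₂.right)))

/-- The bits of the first nodes. -/
noncomputable def nodeBits (live : List ℕ → Bool) (m : ℕ) : List ℕ :=
  (List.range m).map fun i => bif live ((decode (α := List ℕ) i).getD []) then 1 else 0

theorem bitNodes_nodeBits (live : List ℕ → Bool) {m : ℕ} {l : List ℕ} (h : encode l < m) :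
    bitNodes (nodeBits live m) l = live l := by
  rw [bitNodes, nodeBits]
  cases hl : live l <;> simp [h, hl]

/-- Membership consults liveness only at nodes occurring in the code, so finitely many bits of the
oracle computation are enough. -/
theorem value_mem_nodeBits (live : List ℕ → Bool) (c : VecCode TreeBasis) :
    c.value ∈ treeGroup (bitNodes (nodeBits live (nodeBound c))) ↔ c.value ∈ treeGroup live := by
  refine value_mem_substGroup_congr fun i b hb => ?_
  rcases i with n | n | s <;> rcases b with t | y <;> try rfl
  simp only [treeSubst, bitNodes_nodeBits live (encode_lt_nodeBound hb)]

open Classical in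
/-- The characteristic function of the domain and the addition of the numbered group, given enough
bits of live nodes. -/
noncomputable def presentation (bits : List ℕ) (z : ℕ) : ℕ :=
  if z.unpair.1 = 0 then
    if normCode z.unpair.2 = z.unpair.2 ∧
      (vecCodeOf z.unpair.2).value ∈ treeGroup (bitNodes bits) then 1 else 0
  else addCode z.unpair.2.unpair.1 z.unpair.2.unpair.2

theorem primrec_presentation : Primrec₂ presentation := by
  classical
  have hz : Primrec fun t : List ℕ × ℕ => t.2.unpair := Primrec.unpair.comp Primrec.snd
  have h2 : Primrec fun t : List ℕ × ℕ => t.2.unpair.2 := Primrec.snd.comp hz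
  have h3 : PrimrecPred fun t : List ℕ × ℕ => normCode t.2.unpair.2 = t.2.unpair.2 :=
    Primrec.eq.comp (primrec_normCode.comp h2) h2
  have h4 : PrimrecPred fun t : List ℕ × ℕ =>
      (vecCodeOf t.2.unpair.2).value ∈ treeGroup (bitNodes t.1) :=
    primrecRel_value_mem.comp Primrec.fst (primrec_vecCodeOf.comp h2)
  have h5 : PrimrecPred fun t : List ℕ × ℕ => t.2.unpair.1 = 0 :=
    Primrec.eq.comp (Primrec.fst.comp hz) (Primrec.const 0)
  have h6 : Primrec fun t : List ℕ × ℕ => addCode t.2.unpair.2.unpair.1 t.2.unpair.2.unpair.2 :=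
    primrec_addCode.comp (Primrec.fst.comp (Primrec.unpair.comp h2))
      (Primrec.snd.comp (Primrec.unpair.comp h2))
  exact Primrec.ite h5 (Primrec.ite (h3.and h4) (Primrec.const 1) (Primrec.const 0)) h6

/-- The presentation of the tree group with the numbers of bits that are needed. -/
noncomputable def fullPresentation (live : List ℕ → Bool) (z : ℕ) : ℕ :=
  -- On addition queries these bits come from an irrelevant code, but then they are not consulted.
  presentation (nodeBits live (nodeBound (vecCodeOf z.unpair.2))) z

/-- Elements are numbered by the least number of their vector, so the domain consists of the
normalized codes whose value lies in the group. -/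
theorem isGroupIndexIn_treeGroup {X : ℕ → ℕ} {e : ℕ} {live : List ℕ → Bool}
    (h : ∀ z, fullPresentation live z ∈ oraclePhi X e z) :
    IsGroupIndexIn X e (treeGroup live) := by
  classical
  have hdom : ∀ a, fullPresentation live (Nat.pair 0 a) =
      if a ∈ Set.range (fun v : treeGroup live => leastCode v) then 1 else 0 := fun a => by
    have hiff : (normCode a = a ∧ (vecCodeOf a).value ∈ treeGroup live) ↔
        a ∈ Set.range (fun v : treeGroup live => leastCode v) := by
      constructor
      · rintro ⟨h1, h2⟩
        exact ⟨⟨_, h2⟩, (normCode_eq a).symm.trans h1⟩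
      · rintro ⟨v, rfl⟩
        refine ⟨by rw [normCode_eq, value_leastCode], ?_⟩
        rw [value_leastCode]
        exact v.2
    simp only [fullPresentation, presentation, Nat.unpair_pair, if_true, value_mem_nodeBits, hiff]
  refine ⟨fun v => leastCode v, fun v w hvw => Subtype.ext (leastCode_injective hvw),
    fun a ha => ?_, fun a ha => ?_, fun v w => ?_⟩
  · have := h (Nat.pair 0 a)
    rwa [hdom, if_pos ha] at this
  · have := h (Nat.pair 0 a)
    rwa [hdom, if_neg ha] at this
  · have := h (Nat.pair 1 (Nat.pair (leastCode v) (leastCode w)))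
    simp only [fullPresentation, presentation, Nat.unpair_pair, one_ne_zero, if_false,
      addCode_leastCode] at this
    exact this

theorem computableIn_fullPresentation {X : ℕ → ℕ} {c : ℕ × List ℕ → Bool}
    (hc : ComputableIn {(X : ℕ →. ℕ)} c) :
    ComputableIn {(X : ℕ →. ℕ)} fun t : ℕ × ℕ => fullPresentation (liveNodes c t.1) t.2 := by
  have hl : Primrec fun t : ℕ × ℕ => (decode (α := List ℕ) t.2).getD [] :=
    Primrec.option_getD.comp (Primrec.decode.comp Primrec.snd) (Primrec.const [])
  have harg : Primrec fun t : ℕ × ℕ => (t.1,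
      ((decode (α := List ℕ) t.2).getD []).reverse.take
        ((decode (α := List ℕ) t.2).getD []).length.unpair.1) :=
    Primrec.pair Primrec.fst (Primrec.list_take.comp
      (Primrec.fst.comp (Primrec.unpair.comp (Primrec.list_length.comp hl)))
      (Primrec.list_reverse.comp hl))
  have hbit : ComputableIn {(X : ℕ →. ℕ)} fun t : ℕ × ℕ =>
      bif liveNodes c t.1 ((decode (α := List ℕ) t.2).getD []) then 1 else 0 :=
    ComputableIn.cond (hc.comp harg.computableIn) (.const 1) (.const 0)
  have hbound : Primrec fun t : ℕ × ℕ => (t.1, nodeBound (vecCodeOf t.2.unpair.2)) :=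
    Primrec.pair Primrec.fst (primrec_nodeBound.comp (primrec_vecCodeOf.comp
      (Primrec.snd.comp (Primrec.unpair.comp Primrec.snd))))
  have hbits : ComputableIn {(X : ℕ →. ℕ)} fun t : ℕ × ℕ =>
      nodeBits (liveNodes c t.1) (nodeBound (vecCodeOf t.2.unpair.2)) :=
    (ComputableIn.map_range hbit).comp hbound.computableIn
  exact Primrec₂.comp_computableIn (f := presentation) primrec_presentation hbits
    Primrec.snd.computableIn

end Numbering

/-! ## Fixing an argument of a program -/

/-- The Gödel number of a program for a constant function. -/
def constIndex : ℕ → ℕ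
  | 0 => 0
  | n + 1 => 4 * Nat.pair 1 (constIndex n) + 6

theorem oraclePhi_comp (X : ℕ → ℕ) (d e : ℕ) :
    oraclePhi X (4 * Nat.pair d e + 6) = fun n => oraclePhi X e n >>= oraclePhi X d := by
  have h : 4 * Nat.pair d e + 6 = OracleCode.encodeCode
      (.comp (OracleCode.ofNatCode d) (OracleCode.ofNatCode e)) := by
    rw [OracleCode.encodeCode, OracleCode.encodeCode_ofNatCode, OracleCode.encodeCode_ofNatCode]
  rw [oraclePhi, h, OracleCode.ofNatCode_encodeCode]
  rfl

theorem oraclePhi_pair (X : ℕ → ℕ) (d e : ℕ) :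
    oraclePhi X (4 * Nat.pair d e + 5) =
      fun n => Nat.pair <$> oraclePhi X d n <*> oraclePhi X e n := by
  have h : 4 * Nat.pair d e + 5 = OracleCode.encodeCode
      (.pair (OracleCode.ofNatCode d) (OracleCode.ofNatCode e)) := by
    rw [OracleCode.encodeCode, OracleCode.encodeCode_ofNatCode, OracleCode.encodeCode_ofNatCode]
  rw [oraclePhi, h, OracleCode.ofNatCode_encodeCode]
  rfl

theorem oraclePhi_constIndex (X : ℕ → ℕ) (n z : ℕ) :
    oraclePhi X (constIndex n) z = Part.some n := by
  induction n with
  | zero => simp [constIndex, oraclePhi, OracleCode.ofNatCode, OracleCode.eval]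
  | succ n ih =>
    rw [constIndex, oraclePhi_comp]
    beta_reduce
    rw [ih]
    simp [oraclePhi, OracleCode.ofNatCode, OracleCode.eval]

/-- The Gödel number of the program with number `e` with its first argument fixed to be `n`. -/
def curryIndex (e n : ℕ) : ℕ :=
  4 * Nat.pair e (4 * Nat.pair (constIndex n) (4 * Nat.pair 2 3 + 5) + 5) + 6

theorem oraclePhi_curryIndex (X : ℕ → ℕ) (e n z : ℕ) :
    oraclePhi X (curryIndex e n) z = oraclePhi X e (Nat.pair n z) := by
  -- Pairing the two projections gives a program for the identity.
  have hid : oraclePhi X (4 * Nat.pair 2 3 + 5) z = Part.some z := by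
    rw [oraclePhi_pair]
    simp [oraclePhi, OracleCode.ofNatCode, OracleCode.eval, Seq.seq]
  rw [curryIndex, oraclePhi_comp]
  beta_reduce
  rw [oraclePhi_pair]
  beta_reduce
  rw [hid, oraclePhi_constIndex]
  simp only [Seq.seq, Part.map_eq_map, Part.map_some, Part.bind_some]
  exact Part.bind_some _ _

theorem primrec_curryIndex (e : ℕ) : Primrec (curryIndex e) := by
  have hlin : ∀ j, Primrec fun m : ℕ => 4 * m + j := fun j =>
    Primrec.nat_add.comp (Primrec.nat_mul.comp (Primrec.const 4) Primrec.id) (Primrec.const j)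
  have hc : Primrec constIndex := by
    refine (Primrec.nat_rec₁ (f := fun _ i => 4 * Nat.pair 1 i + 6) 0
      ((hlin 6).comp (Primrec₂.natPair.comp (Primrec.const 1) Primrec.snd)).to₂).of_eq fun n => ?_
    induction n with
    | zero => rfl
    | succ n ih => rw [constIndex, ← ih]
  exact (hlin 6).comp (Primrec₂.natPair.comp (Primrec.const e) ((hlin 5).comp
    (Primrec₂.natPair.comp hc (Primrec.const _))))

/-! ### The reduction -/

theorem mainTheorem2 (X : ℕ → ℕ) (S : Set ℕ) (hS : IsPi11In X S) :
    (fun n : ℕ => n ∈ S) ≤₀ (fun e : ℕ => e ∈ cancellableIndexSet.{u} X) := by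
  obtain ⟨c, hc, hcS⟩ := hS.exists_test
  have hcomp : ComputableIn {(X : ℕ →. ℕ)} fun m : ℕ =>
      fullPresentation (liveNodes c m.unpair.1) m.unpair.2 :=
    (computableIn_fullPresentation hc).comp Primrec.unpair.computableIn
  obtain ⟨e, he⟩ := (exists_oraclePhi_iff X _).2 (RecursiveIn.iff_nat.1 hcomp)
  have hindex : ∀ n, IsGroupIndexIn X (curryIndex e n) (treeGroup (liveNodes c n)) := fun n =>
    isGroupIndexIn_treeGroup fun z => by
      rw [oraclePhi_curryIndex, he]
      simp
  refine ⟨curryIndex e, (primrec_curryIndex e).to_comp, fun n => ?_⟩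
  refine (hcS n).trans ?_
  constructor
  · intro h
    exact ⟨treeGroup (liveNodes c n), inferInstance, hindex n, inferInstance,
      isCancellable_treeGroup fun hp => h (exists_path_of_hasPath hp)⟩
  · rintro ⟨A, _, hA, -, hcanc⟩ ⟨h, hh⟩
    -- The index set may witness cancellability through another group, but the index determines it
    -- up to isomorphism.
    obtain ⟨f⟩ := hA.nonempty_addEquiv (hindex n)
    exact not_isCancellable_treeGroup (σ := fun m => (initSeg h m).reverse)
      (liveNodes_of_path hh) (by simp) (fun m => by simp [initSeg_succ])
      (hcanc.of_addEquiv f)
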